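/- Let $K$ be a closed convex subset of $\mathbf R^d$ whose dimension (the dimension of its affine hull) is $k=\dim(K)\in\{1,\dots,d-1\}$. Put $\Omega=\mathbf R^d\setminus K$, $d_\Gamma(x)=\inf_{y\in K}|x-y|$ for $x\in\Omega$, and $c_\Omega=c\circ d_\Gamma$ with $c(s)=s^{\delta}(1+s)^{\delta'-\delta}$, where $\delta,\delta'\ge 0$. Let $1<p<\infty$, let $H\varphi=-\sum_{j=1}^d\partial_j(c_\Omega\,\partial_j\varphi)$, and let $$\nu_p(\Omega)=\inf\Big\{\int_\Omega|H\varphi|^p\Big/\int_\Omega|c_\Omega\,d_\Gamma^{-2}\varphi|^p:\ 0\ne\varphi\in C_c^2(\Omega)\Big\}$$ (real-valued functions) be the optimal constant in the Rellich inequality $\int_\Omega|H\varphi|^p\ge\nu\int_\Omega|c_\Omega d_\Gamma^{-2}\varphi|^p$. Let $k_\infty=\liminf_{r\to\infty}\log|K\cap B_r|/\log r$, where $B_r$ is the ball of radius $r$ centred at the origin and $|\cdot|$ is the $k$-dimensional Lebesgue measure on the affine hull of $K$. Write $\delta\wedge\delta'=\min(\delta,\delta')$. Then: 1. If $d-k+p\delta-2p\ge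 0$, then $$\nu_p(\Omega)\le\left(\frac{(p-1)(d-k)(d-k+p\delta-2p)}{p^2}\right)^p.$$ 2. If $k_\infty=k$ and $d-k+p(\delta\wedge\delta')-2p\ge 0$, then $$\nu_p(\Omega)\le\left(\frac{(p-1)(d-k)(d-k+p(\delta\wedge\delta')-2p)}{p^2}\right)^p.$$ 3. If $\delta=\delta'\in[0,2)$ and $d-k+p\delta-2p\ge 0$, then $$\nu_p(\Omega)=\left(\frac{(p-1)(d-k)(d-k+p\delta-2p)}{p^2}\right)^p.$$ -/

import Mathlib

open MeasureTheory Filter Set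
open scoped ENNReal

noncomputable section

namespace Rellich

/-- `ℝ^d` with its Euclidean norm. -/
abbrev Space (d : ℕ) : Type := EuclideanSpace ℝ (Fin d)

/-- The domain `Ω = ℝ^d \ K`. -/
def domain {d : ℕ} (K : Set (Space d)) : Set (Space d) := Kᶜ

/-- The distance `d_Γ(x) = inf_{y ∈ Ωᶜ} |x - y|` to the boundary of `Ω = ℝ^d \ K`,
where `Ωᶜ = K`. -/
def bdryDist {d : ℕ} (K : Set (Space d)) (x : Space d) : ℝ := Metric.infDist x (domain K)ᶜ

/-- The coefficient `c(s) = s^δ (1 + s)^(δ' - δ)`. -/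
def coeff (δ δ' s : ℝ) : ℝ := s ^ δ * (1 + s) ^ (δ' - δ)

/-- The weight `c_Ω = c ∘ d_Γ`. -/
def weight {d : ℕ} (δ δ' : ℝ) (K : Set (Space d)) (x : Space d) : ℝ := coeff δ δ' (bdryDist K x)

/-- The partial derivative `∂_j f`. -/
def pderiv {d : ℕ} (j : Fin d) (f : Space d → ℝ) (x : Space d) : ℝ :=
  fderiv ℝ f x (EuclideanSpace.single j 1)

/-- The operator `H φ = -∑_j ∂_j (c_Ω ∂_j φ) = -div (c_Ω ∇φ)`. If `K` is closed and convex then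
`d_Γ`, and hence `c_Ω`, is continuously differentiable on `Ω`, so for `φ` of class `C²` all
derivatives are classical ones at every point of `Ω`. -/
def H {d : ℕ} (δ δ' : ℝ) (K : Set (Space d)) (φ : Space d → ℝ) (x : Space d) : ℝ :=
  -∑ j : Fin d, pderiv j (fun y => weight δ δ' K y * pderiv j φ y) x

/-- The test functions `C_c^2(Ω)`: real-valued, of class `C²`, with compact support contained
in `Ω`. -/
def IsTest {d : ℕ} (Ω : Set (Space d)) (φ : Space d → ℝ) : Prop :=
  ContDiff ℝ 2 φ ∧ HasCompactSupport φ ∧ tsupport φ ⊆ Ω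

/-- The optimal Rellich constant
`ν_p(Ω) = inf { ∫_Ω |Hφ|^p / ∫_Ω |c_Ω d_Γ^(-2) φ|^p : 0 ≠ φ ∈ C_c^2(Ω) }`. -/
def nu {d : ℕ} (p δ δ' : ℝ) (K : Set (Space d)) : ℝ :=
  sInf {r : ℝ | ∃ φ : Space d → ℝ, IsTest (domain K) φ ∧ φ ≠ 0 ∧
    r = (∫ x in domain K, |H δ δ' K φ x| ^ p) /
      ∫ x in domain K, |weight δ δ' K x / bdryDist K x ^ 2 * φ x| ^ p}

/-- The dimension of `K`, i.e. of its affine hull. -/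
def dim {d : ℕ} (K : Set (Space d)) : ℕ := Module.finrank ℝ (affineSpan ℝ K).direction

/-- The dimension at infinity `liminf_{r → ∞} log |K ∩ B_r| / log r`, where `|·|` is the
`k`-dimensional Lebesgue measure on the affine hull of `K`, with `k = dim K`. It is written as the
normalized `k`-dimensional Hausdorff measure, which agrees with Lebesgue measure on isometric
copies of `ℝ^k`. The centre of the balls `B_r` does not affect the limit inferior. -/
def dimAtInfinity {d : ℕ} (K : Set (Space d)) : EReal :=
  liminf (fun r : ℝ =>
    ENNReal.log (Measure.euclideanHausdorffMeasure (dim K) (K ∩ Metric.ball (0 : Space d) r)) /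
      (Real.log r : EReal)) atTop

end Rellich

end

/-! Write `a = d - k`, `A = a + pδ - 2p`, let `P` be the nearest-point map of `K` and `D` the
distance to `K`.

Lower bound (`δ = δ' ≤ 2`). The only geometric input is `div (x - P x) ≥ a`, in the weak sense: `P`
is 1-Lipschitz with values in a `k`-dimensional affine space, so `div P ≤ k`. Integrate `Hφ` against
`D^((δ-2)(p-1)) |φ|^(p-2) φ` by parts. With `n = ∇φ · (x - P x)`, use `D² |∇φ|² ≥ n² ≥ -2tφn -
t²φ²`. The terms linear in `n` are the derivative, in direction `x - P x`, of a nonnegative function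
of `φ`, so the divergence bound applies. The best choice `t = A/p` gives `∫ Hφ D^((δ-2)(p-1))
|φ|^(p-2) φ ≥ C ∫ |D^(δ-2) φ|^p` with `C = (p-1) a A / p²`, and Young's inequality raises this to
the `p`-th power. The power `|s|^(p-2) s` is smoothed by `regPow` and the smoothing is removed by
dominated convergence. See `IsNearestPointMap.integral_infDist_rpow_le`,
`regularized_le_integral_H_mul`, `mul_integral_le_integral_H_mul`.

Upper bound. Above a flat `k`-ball contained in `K` the distance is the norm `s` of the component
orthogonal to the affine hull. If the weight there behaves like `s^σ`, then `s^(-α)` with `α = (a +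
pσ - 2p)/p` is an approximate extremal: `H s^(-α) = α(a-2+σ-α) s^(σ-2-α)`, the factor equals the
claimed constant for `σ`, and both integrals diverge logarithmically. Cutting off slowly in `log s`,
and along the flat ball on a scale much larger than `s`, costs a vanishing proportion
(`abs_H_testFn_sub_le`, `nu_le_of_flat`, `nu_le_of_forall_flat`). Small `s` above a relative
interior point gives `σ = δ`. Large `s` gives `σ = δ'`, but needs arbitrarily large flat balls in
`K`; these exist when `k_∞ = k`, because a convex set without a ball of some fixed radius has volume
growth `O(r^(k-1))` (`exists_measure_inter_ball_le`). -/

namespace Rellich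

open Metric Topology RealInnerProductSpace

/-! ### Nearest-point map and distance function of a closed convex set. -/

section NearestPoint

variable {E : Type*} [NormedAddCommGroup E] [InnerProductSpace ℝ E]

/-- `P` maps every point to its nearest point in the convex set `K`. -/
structure IsNearestPointMap (K : Set E) (P : E → E) : Prop where
  mem : ∀ x, P x ∈ K
  norm_sub : ∀ x, ‖x - P x‖ = infDist x K
  inner_le : ∀ x, ∀ y ∈ K, ⟪x - P x, y - P x⟫ ≤ 0

theorem exists_isNearestPointMap [FiniteDimensional ℝ E] {K : Set E} (hK : IsClosed K)
    (hc : Convex ℝ K) (hne : K.Nonempty) : ∃ P, IsNearestPointMap K P := by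
  have h : ∀ x, ∃ y ∈ K, infDist x K = dist x y := fun x => hK.exists_infDist_eq_dist hne x
  choose P hP hd using h
  refine ⟨P, hP, fun x => by rw [hd, dist_eq_norm], fun x => ?_⟩
  rw [← norm_eq_iInf_iff_real_inner_le_zero hc (hP x), ← dist_eq_norm, ← hd,
    infDist_eq_iInf]
  simp only [dist_eq_norm]

namespace IsNearestPointMap

variable {K : Set E} {P : E → E} (hP : IsNearestPointMap K P)
include hP

/-- Adding the two variational inequalities gives `‖P x - P y‖² ≤ ⟪x - y, P x - P y⟫`, and
Cauchy–Schwarz finishes. -/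
theorem lipschitz : LipschitzWith 1 P := by
  refine LipschitzWith.of_dist_le_mul fun x y => ?_
  have h1 := hP.inner_le x (P y) (hP.mem y)
  have h2 := hP.inner_le y (P x) (hP.mem x)
  rw [dist_eq_norm, dist_eq_norm, NNReal.coe_one, one_mul]
  have h3 : ‖P x - P y‖ ^ 2 ≤ ⟪x - y, P x - P y⟫ := by
    have e1 : P y - P x = -(P x - P y) := by abel
    rw [e1, inner_neg_right] at h1
    have e2 : x - y = (x - P x) - (y - P y) + (P x - P y) := by abel
    rw [e2, inner_add_left, inner_sub_left, real_inner_self_eq_norm_sq]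
    linarith
  have h4 := real_inner_le_norm (x - y) (P x - P y)
  by_contra! h
  nlinarith [norm_nonneg (P x - P y), norm_nonneg (x - y)]

/-- Testing the distance at `x + h` with the competitor `P x`, and at `x` with `P (x + h)`, bounds
the remainder from both sides by a multiple of `‖h‖²`. Only the Lipschitz bound on `P` is used, not
differentiability. -/
theorem hasFDerivAt_infDist_sq (x : E) :
    HasFDerivAt (fun y => infDist y K ^ 2) (2 • innerSL ℝ (x - P x)) x := by
  rw [hasFDerivAt_iff_isLittleO_nhds_zero]
  have key : ∀ h : E, ‖infDist (x + h) K ^ 2 - infDist x K ^ 2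
      - (2 • innerSL ℝ (x - P x)) h‖ ≤ 3 * ‖h‖ ^ 2 := by
    intro h
    have e0 : (2 • innerSL ℝ (x - P x)) h = 2 * ⟪x - P x, h⟫ := by
      simp [inner_sub_left]
    have u1 : infDist (x + h) K ^ 2 ≤ ‖x + h - P x‖ ^ 2 := by
      have := infDist_le_dist_of_mem (x := x + h) (hP.mem x)
      rw [dist_eq_norm] at this
      exact pow_le_pow_left₀ infDist_nonneg this 2
    have u2 : infDist x K ^ 2 ≤ ‖x - P (x + h)‖ ^ 2 := by
      have := infDist_le_dist_of_mem (x := x) (hP.mem (x + h))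
      rw [dist_eq_norm] at this
      exact pow_le_pow_left₀ infDist_nonneg this 2
    have e1 : x + h - P x = (x - P x) + h := by abel
    have e2 : x - P (x + h) = (x + h - P (x + h)) - h := by abel
    rw [e1, norm_add_sq_real, hP.norm_sub] at u1
    rw [e2, norm_sub_sq_real, hP.norm_sub] at u2
    have e3 : x + h - P (x + h) = (x - P x) + (h - (P (x + h) - P x)) := by abel
    have u3 : ⟪h - (P (x + h) - P x), h⟫ ≥ - ‖h‖ ^ 2 := by
      rw [inner_sub_left, real_inner_self_eq_norm_sq]
      have := real_inner_le_norm (P (x + h) - P x) h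
      have l := hP.lipschitz.dist_le_mul (x + h) x
      rw [dist_eq_norm, dist_eq_norm] at l
      simp only [NNReal.coe_one, one_mul, add_sub_cancel_left] at l
      nlinarith [norm_nonneg h]
    rw [e3, inner_add_left] at u2
    rw [e0, Real.norm_eq_abs, abs_le]
    constructor <;> nlinarith [sq_nonneg ‖h‖]
  refine Asymptotics.IsBigO.trans_isLittleO (g := fun h : E => ‖h‖ ^ 2)
    (Asymptotics.IsBigO.of_bound 3 (Eventually.of_forall fun h => ?_)) ?_
  · simpa using key h
  · exact Asymptotics.isLittleO_norm_pow_id one_lt_two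

theorem infDist_pos (hK : IsClosed K) {x : E} (hx : x ∉ K) : 0 < infDist x K :=
  (hK.notMem_iff_infDist_pos ⟨_, hP.mem x⟩).1 hx

theorem hasFDerivAt_infDist (hK : IsClosed K) {x : E} (hx : x ∉ K) :
    HasFDerivAt (fun y => infDist y K) ((infDist x K)⁻¹ • innerSL ℝ (x - P x)) x := by
  have hpos := hP.infDist_pos hK hx
  have h := (hP.hasFDerivAt_infDist_sq x).sqrt (by positivity)
  have e : (fun y => √(infDist y K ^ 2)) = fun y => infDist y K := by
    ext y; exact Real.sqrt_sq infDist_nonneg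
  rw [e, Real.sqrt_sq infDist_nonneg] at h
  convert h using 1
  ext v
  simp
  field_simp

/-- The gradient is explicit and continuous. One derivative suffices, since `H` differentiates the
weight only once. -/
theorem contDiffOn_infDist (hK : IsClosed K) : ContDiffOn ℝ 1 (fun y => infDist y K) Kᶜ := by
  rw [show (1 : WithTop ℕ∞) = 0 + 1 by simp, contDiffOn_succ_iff_fderiv_of_isOpen hK.isOpen_compl]
  refine ⟨fun x hx => (hP.hasFDerivAt_infDist hK hx).differentiableAt.differentiableWithinAt, by simp, ?_⟩
  rw [contDiffOn_zero]
  have : ContinuousOn (fun x => (infDist x K)⁻¹ • innerSL ℝ (x - P x)) Kᶜ := by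
    refine ContinuousOn.smul (ContinuousOn.inv₀ (continuous_infDist_pt K).continuousOn
      fun x hx => (hP.infDist_pos hK hx).ne') ?_
    exact ((innerSL ℝ).continuous.comp (continuous_id.sub hP.lipschitz.continuous)).continuousOn
  exact this.congr fun x hx => (hP.hasFDerivAt_infDist hK hx).fderiv

/-- The composition of a function of class `C¹` on `(0, ∞)` with the distance to `K`. -/
theorem contDiffOn_comp_infDist (hK : IsClosed K) {f : ℝ → ℝ} (hf : ContDiffOn ℝ 1 f (Ioi 0)) :
    ContDiffOn ℝ 1 (fun y => f (infDist y K)) Kᶜ :=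
  hf.comp (hP.contDiffOn_infDist hK) fun _ hx => hP.infDist_pos hK hx

theorem hasFDerivAt_infDist_rpow (hK : IsClosed K) (r : ℝ) {x : E} (hx : x ∉ K) :
    HasFDerivAt (fun y => infDist y K ^ r)
      ((r * infDist x K ^ (r - 2)) • innerSL ℝ (x - P x)) x := by
  have hpos := hP.infDist_pos hK hx
  have h := (hP.hasFDerivAt_infDist hK hx).rpow_const (p := r) (Or.inl hpos.ne')
  convert h using 1
  rw [smul_smul, mul_assoc, show r - 2 = (r - 1) - 1 by ring, Real.rpow_sub_one hpos.ne' (r - 1)]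
  rfl

theorem contDiffOn_infDist_rpow (hK : IsClosed K) (r : ℝ) :
    ContDiffOn ℝ 1 (fun y => infDist y K ^ r) Kᶜ :=
  hP.contDiffOn_comp_infDist hK (f := fun s => s ^ r) fun _ hs =>
    (contDiffAt_id.rpow_const_of_ne (ne_of_gt hs)).contDiffWithinAt

end IsNearestPointMap

/-- A function of class `C^n` on an open set, multiplied by a `C^n` function supported in it, is
`C^n` everywhere. -/
theorem contDiff_mul_of_tsupport_subset {n : WithTop ℕ∞} {U : Set E} (hU : IsOpen U)
    {f g : E → ℝ} (hf : ContDiffOn ℝ n f U) (hg : ContDiff ℝ n g) (hs : tsupport g ⊆ U) :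
    ContDiff ℝ n (fun x => f x * g x) := by
  rw [contDiff_iff_contDiffAt]
  intro x
  by_cases hx : x ∈ tsupport g
  · exact (hf.contDiffAt (hU.mem_nhds (hs hx))).mul hg.contDiffAt
  · have : (fun x => f x * g x) =ᶠ[𝓝 x] fun _ => 0 := by
      filter_upwards [notMem_tsupport_iff_eventuallyEq.1 hx] with y hy
      simp [hy]
    exact contDiffAt_const.congr_of_eventuallyEq this

end NearestPoint

end Rellich

namespace Rellich

open Metric Topology RealInnerProductSpace

/-! ### Weak lower bounds for the divergence of `x - P x` and of its weighted versions. -/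

section WeakDivergence

theorem lipschitzWith_inner_const {E F : Type*} [NormedAddCommGroup E]
    [InnerProductSpace ℝ E] [PseudoMetricSpace F] {g : F → E}
    (hg : LipschitzWith 1 g) {b : E} (hb : ‖b‖ = 1) : LipschitzWith 1 fun x => ⟪b, g x⟫ := by
  refine LipschitzWith.of_dist_le_mul fun x y => ?_
  rw [Real.dist_eq, ← inner_sub_right]
  refine (abs_real_inner_le_norm _ _).trans ?_
  rw [hb, one_mul, ← dist_eq_norm]
  exact hg.dist_le_mul x y

variable {E : Type*} [NormedAddCommGroup E] [InnerProductSpace ℝ E] [FiniteDimensional ℝ E]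
  [MeasurableSpace E] [BorelSpace E]

/-- Integration by parts with a merely Lipschitz factor, so that it applies to the components of
`P`. -/
theorem integral_mul_fderiv_eq_neg_lineDeriv {f u : E → ℝ} {C : NNReal} (hf : LipschitzWith C f)
    (hu : ContDiff ℝ 1 u) (hc : HasCompactSupport u) (v : E) :
    ∫ x, f x * fderiv ℝ u x v = -∫ x, lineDeriv ℝ f x v * u x := by
  obtain ⟨D, hD⟩ := hu.lipschitzWith_of_hasCompactSupport hc one_ne_zero
  rw [LipschitzWith.integral_lineDeriv_mul_eq hf hD hc v, ← integral_neg]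
  refine integral_congr_ae (Eventually.of_forall fun x => ?_)
  simp only
  rw [(hu.differentiable one_ne_zero x).lineDeriv_eq_fderiv, map_neg]
  ring

theorem integral_fderiv_eq_zero {u : E → ℝ}
    (hu : ContDiff ℝ 1 u) (hc : HasCompactSupport u) (v : E) :
    ∫ x, fderiv ℝ u x v = 0 := by
  have := integral_mul_fderiv_eq_neg_lineDeriv (f := fun _ => (1 : ℝ)) (C := 0)
    (LipschitzWith.const 1) hu hc v
  simpa [lineDeriv] using this

/-- Weak form of `div (x - P x) ≥ dim E - dim K`. -/
theorem IsNearestPointMap.integral_le_neg_integral_fderiv {K : Set E} {P : E → E}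
    (hP : IsNearestPointMap K P) {u : E → ℝ} (hu : ContDiff ℝ 1 u) (hc : HasCompactSupport u)
    (h0 : ∀ x, 0 ≤ u x) :
    ((Module.finrank ℝ E : ℝ) - Module.finrank ℝ (affineSpan ℝ K).direction) * ∫ x, u x ≤
      -∫ x, fderiv ℝ u x (x - P x) := by
  set V := (affineSpan ℝ K).direction
  let e := stdOrthonormalBasis ℝ E
  let b := stdOrthonormalBasis ℝ V
  set p₀ := P 0
  have hfc : Continuous (fderiv ℝ u) := hu.continuous_fderiv one_ne_zero
  have hfs : HasCompactSupport (fderiv ℝ u) := hc.fderiv ℝ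
  have hPV : ∀ x, P x - p₀ ∈ V := fun x =>
    AffineSubspace.vsub_mem_direction (subset_affineSpan ℝ K (hP.mem x))
      (subset_affineSpan ℝ K (hP.mem 0))
  -- `x` is expanded in a basis of the whole space, but `P x - p₀` lies in `V` and needs only `dim
  -- V` vectors: this is how the codimension appears.
  have hid : ∀ x, fderiv ℝ u x (x - P x) = ∑ j, ⟪e j, x⟫ * fderiv ℝ u x (e j)
      - (∑ i, ⟪(b i : E), P x - p₀⟫ * fderiv ℝ u x (b i)) - fderiv ℝ u x p₀ := by
    intro x
    have h1 : x = ∑ j, ⟪e j, x⟫ • e j := (e.sum_repr' x).symm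
    have h2 : P x - p₀ = ∑ i, ⟪(b i : E), P x - p₀⟫ • (b i : E) := by
      have := congrArg (Subtype.val) (b.sum_repr' ⟨P x - p₀, hPV x⟩).symm
      simpa using this
    have h3 : x - P x = x - (P x - p₀) - p₀ := by abel
    rw [h3, map_sub, map_sub]
    congr 2
    · have := congrArg (fderiv ℝ u x) h1
      simpa using this
    · have := congrArg (fderiv ℝ u x) h2
      simpa using this
  have hint : ∀ (f : E → ℝ) (v : E), Continuous f → Integrable fun x => f x * fderiv ℝ u x v := by
    intro f v hf
    refine (hf.mul (hfc.clm_apply continuous_const)).integrable_of_hasCompactSupport ?_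
    refine HasCompactSupport.mul_left ?_
    exact (hfs.comp_left (g := fun L : E →L[ℝ] ℝ => L v) rfl)
  have i1 : ∀ j, Integrable fun x => ⟪e j, x⟫ * fderiv ℝ u x (e j) := fun j =>
    hint _ _ (by fun_prop)
  have cP : Continuous P := hP.lipschitz.continuous
  have i2 : ∀ i, Integrable fun x => ⟪(b i : E), P x - p₀⟫ * fderiv ℝ u x (b i) := fun i =>
    hint _ _ (by fun_prop)
  have i3 : Integrable fun x => fderiv ℝ u x p₀ := by
    simpa using hint (fun _ => 1) p₀ continuous_const
  simp_rw [hid]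
  have s1 : Integrable fun x => ∑ j, ⟪e j, x⟫ * fderiv ℝ u x (e j) :=
    integrable_finsetSum _ fun j _ => i1 j
  have s2 : Integrable fun x => ∑ i, ⟪(b i : E), P x - p₀⟫ * fderiv ℝ u x (b i) :=
    integrable_finsetSum _ fun j _ => i2 j
  have s12 : Integrable fun x => ∑ j, ⟪e j, x⟫ * fderiv ℝ u x (e j)
      - ∑ i, ⟪(b i : E), P x - p₀⟫ * fderiv ℝ u x (b i) := s1.sub s2
  rw [integral_sub s12 i3, integral_sub s1 s2,
    integral_finsetSum _ fun j _ => i1 j, integral_finsetSum _ fun j _ => i2 j,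
    integral_fderiv_eq_zero hu hc]
  have a1 : ∀ j, ∫ x, ⟪e j, x⟫ * fderiv ℝ u x (e j) = - ∫ x, u x := by
    intro j
    have hl : LipschitzWith 1 fun x => ⟪e j, x⟫ :=
      lipschitzWith_inner_const LipschitzWith.id (e.orthonormal.1 j)
    rw [integral_mul_fderiv_eq_neg_lineDeriv hl hu hc]
    congr 1
    refine integral_congr_ae (Eventually.of_forall fun x => ?_)
    have : lineDeriv ℝ (fun x => ⟪e j, x⟫) x (e j) = 1 := by
      have hd : HasFDerivAt (fun x => ⟪e j, x⟫) (innerSL ℝ (e j)) x :=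
        (innerSL ℝ (e j)).hasFDerivAt
      rw [hd.hasLineDerivAt (e j) |>.lineDeriv]
      simp
    simp only [this, one_mul]
  -- The derivative of a component of `P` along `b i` is at most `1`; the sign of `u` turns this
  -- into a one-sided bound.
  have a2 : ∀ i, - ∫ x, u x ≤ ∫ x, ⟪(b i : E), P x - p₀⟫ * fderiv ℝ u x (b i) := by
    intro i
    have hb : ‖(b i : E)‖ = 1 := b.orthonormal.1 i
    have hl : LipschitzWith 1 fun x => P x - p₀ := by
      simpa using hP.lipschitz.sub (LipschitzWith.const p₀)
    have hl' := lipschitzWith_inner_const hl hb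
    rw [integral_mul_fderiv_eq_neg_lineDeriv hl' hu hc]
    apply neg_le_neg
    have hui : Integrable u := hu.continuous.integrable_of_hasCompactSupport hc
    have hle : ∀ x, ‖lineDeriv ℝ (fun x => ⟪(b i : E), P x - p₀⟫) x (b i)‖ ≤ 1 := by
      intro x
      have := norm_lineDeriv_le_of_lipschitz ℝ hl' (x₀ := x) (v := (b i : E))
      simpa [hb] using this
    refine integral_mono ?_ hui fun x => ?_
    · refine hui.bdd_mul (c := 1) ?_ (Eventually.of_forall hle)
      exact (measurable_lineDeriv hl'.continuous).aestronglyMeasurable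
    · have := (le_abs_self _).trans (hle x)
      simp only
      nlinarith [h0 x]
  have s1 := Finset.sum_congr rfl fun j (_ : j ∈ Finset.univ) => a1 j
  have s2 := Finset.sum_le_sum fun i (_ : i ∈ Finset.univ) => a2 i
  simp only [Finset.sum_const, Finset.card_univ, Fintype.card_fin, nsmul_eq_mul] at s1 s2
  rw [s1]
  linarith

/-- Weak form of `div (d^m ∇d) ≥ (m + dim E - dim K - 1) d^(m - 1)`, where `d` is the distance
to `K`. -/
theorem IsNearestPointMap.integral_infDist_rpow_le {K : Set E} {P : E → E}
    (hP : IsNearestPointMap K P) (hK : IsClosed K) (r : ℝ) {g : E → ℝ} (hg : ContDiff ℝ 1 g)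
    (hc : HasCompactSupport g) (hs : tsupport g ⊆ Kᶜ) (h0 : ∀ x, 0 ≤ g x) :
    (r + Module.finrank ℝ E - Module.finrank ℝ (affineSpan ℝ K).direction) *
        ∫ x, infDist x K ^ r * g x ≤
      -∫ x, infDist x K ^ r * fderiv ℝ g x (x - P x) := by
  have hu : ContDiff ℝ 1 fun x => infDist x K ^ r * g x :=
    contDiff_mul_of_tsupport_subset hK.isOpen_compl (hP.contDiffOn_infDist_rpow hK r) hg hs
  have key := hP.integral_le_neg_integral_fderiv hu hc.mul_left fun x =>
    mul_nonneg (Real.rpow_nonneg infDist_nonneg _) (h0 x)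
  -- The radial field `x - P x` acts on `d^r` as multiplication by `r`.
  have hfd : ∀ x, fderiv ℝ (fun x => infDist x K ^ r * g x) x (x - P x) =
      infDist x K ^ r * fderiv ℝ g x (x - P x) + r * (infDist x K ^ r * g x) := by
    intro x
    by_cases hx : x ∈ tsupport g
    · have hxK := hs hx
      have hpos := hP.infDist_pos hK hxK
      rw [((hP.hasFDerivAt_infDist_rpow hK r hxK).fun_mul
        (hg.differentiable one_ne_zero x).hasFDerivAt).fderiv]
      have h2 : infDist x K ^ r = infDist x K ^ (r - 2) * infDist x K ^ 2 := by
        rw [← Real.rpow_natCast, ← Real.rpow_add hpos]; congr 1; simp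
      have h3 : innerSL ℝ (x - P x) (x - P x) = infDist x K ^ 2 := by
        rw [innerSL_apply_apply, real_inner_self_eq_norm_sq, hP.norm_sub]
      simp only [add_apply, smul_apply, smul_eq_mul, h3]
      rw [h2]; ring
    · have he := notMem_tsupport_iff_eventuallyEq.1 hx
      have h1 : fderiv ℝ g x = 0 := by rw [he.fderiv_eq]; simp
      have h2 : fderiv ℝ (fun x => infDist x K ^ r * g x) x = 0 := by
        have : (fun x => infDist x K ^ r * g x) =ᶠ[𝓝 x] fun _ => 0 := by
          filter_upwards [he] with y hy
          simp [hy]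
        rw [this.fderiv_eq]; simp
      rw [h1, h2, he.self_of_nhds]; simp
  simp_rw [hfd] at key
  have i2 : Integrable fun x => infDist x K ^ r * g x :=
    hu.continuous.integrable_of_hasCompactSupport hc.mul_left
  have i1 : Integrable fun x => infDist x K ^ r * fderiv ℝ g x (x - P x) := by
    have h1 : Continuous fun x => fderiv ℝ (fun x => infDist x K ^ r * g x) x (x - P x) :=
      (hu.continuous_fderiv one_ne_zero).clm_apply
        (continuous_id.sub hP.lipschitz.continuous)
    have h2 : Integrable fun x => fderiv ℝ (fun x => infDist x K ^ r * g x) x (x - P x) := by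
      refine h1.integrable_of_hasCompactSupport ?_
      refine HasCompactSupport.of_support_subset_isCompact
        ((hc.mul_left (f := fun x => infDist x K ^ r)).fderiv ℝ).isCompact fun x hx => ?_
      refine subset_tsupport _ fun h => hx ?_
      change fderiv ℝ (fun x => infDist x K ^ r * g x) x = 0 at h
      simp only [h, zero_apply]
    refine (h2.sub (i2.const_mul r)).congr (Eventually.of_forall fun x => ?_)
    simp [hfd]
  rw [integral_add i1 (i2.const_mul r), integral_const_mul] at key
  linarith

end WeakDivergence

end Rellich

namespace Rellich

open Metric Topology RealInnerProductSpace

/-! ### Smooth regularization of the power nonlinearity. -/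

section Regularization

/-- The regularization `s (s² + ε)^((p - 2) / 2)` of `|s|^(p - 2) s`. -/
noncomputable def regPow (p ε s : ℝ) : ℝ := s * (s ^ 2 + ε) ^ ((p - 2) / 2)

/-- The derivative of `regPow`. -/
noncomputable def regPowDeriv (p ε s : ℝ) : ℝ :=
  (s ^ 2 + ε) ^ ((p - 2) / 2) + (p - 2) * s ^ 2 * (s ^ 2 + ε) ^ ((p - 4) / 2)

/-- A primitive of `2 t s F'(s) + γ F(s)`, where `F = regPow p ε`. -/
noncomputable def regPrim (p t γ ε s : ℝ) : ℝ :=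
  2 * t * (s * regPow p ε s) + (γ - 2 * t) * (((s ^ 2 + ε) ^ (p / 2) - ε ^ (p / 2)) / p)

variable {p t γ ε : ℝ}

theorem hasDerivAt_sq_add_rpow (hε : 0 < ε) (r s : ℝ) :
    HasDerivAt (fun s : ℝ => (s ^ 2 + ε) ^ r) (2 * r * s * (s ^ 2 + ε) ^ (r - 1)) s := by
  have h : HasDerivAt (fun s : ℝ => s ^ 2 + ε) (2 * s) s := by
    simpa using (hasDerivAt_pow 2 s).add_const ε
  convert h.rpow_const (p := r) (Or.inl (by positivity)) using 1
  ring

theorem hasDerivAt_regPow (hε : 0 < ε) (s : ℝ) :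
    HasDerivAt (regPow p ε) (regPowDeriv p ε s) s := by
  have h := (hasDerivAt_id s).fun_mul (hasDerivAt_sq_add_rpow hε ((p - 2) / 2) s)
  refine h.congr_deriv ?_
  rw [regPowDeriv, show (p - 2) / 2 - 1 = (p - 4) / 2 by ring]
  simp only [id]
  ring

theorem hasDerivAt_regPrim (hp : p ≠ 0) (hε : 0 < ε) (s : ℝ) :
    HasDerivAt (regPrim p t γ ε) (2 * t * s * regPowDeriv p ε s + γ * regPow p ε s) s := by
  have h1 := ((hasDerivAt_id s).fun_mul (hasDerivAt_regPow (p := p) hε s)).const_mul (2 * t)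
  have h2 := (((hasDerivAt_sq_add_rpow hε (p / 2) s).sub_const (ε ^ (p / 2))).div_const p).const_mul
    (γ - 2 * t)
  refine (h1.fun_add h2).congr_deriv ?_
  rw [regPow, show p / 2 - 1 = (p - 2) / 2 by ring]
  simp only [id]
  field_simp
  ring

theorem contDiff_sq_add_rpow (hε : 0 < ε) (r : ℝ) (n : WithTop ℕ∞) :
    ContDiff ℝ n fun s : ℝ => (s ^ 2 + ε) ^ r :=
  ContDiff.rpow_const_of_ne (by fun_prop) fun s => by positivity

theorem contDiff_regPow (hε : 0 < ε) (n : WithTop ℕ∞) : ContDiff ℝ n (regPow p ε) :=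
  contDiff_id.mul (contDiff_sq_add_rpow hε _ n)

theorem contDiff_regPrim (hε : 0 < ε) (n : WithTop ℕ∞) : ContDiff ℝ n (regPrim p t γ ε) :=
  (contDiff_const.mul (contDiff_id.mul (contDiff_regPow hε n))).add
    (contDiff_const.mul (((contDiff_sq_add_rpow hε _ n).sub contDiff_const).div_const p))

theorem continuous_regPowDeriv (hε : 0 < ε) : Continuous (regPowDeriv p ε) :=
  (contDiff_sq_add_rpow hε _ 0).continuous.add ((by fun_prop : Continuous fun s : ℝ =>
    (p - 2) * s ^ 2).mul (contDiff_sq_add_rpow hε _ 0).continuous)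

@[simp] theorem regPow_zero : regPow p ε 0 = 0 := by simp [regPow]

@[simp] theorem regPrim_zero : regPrim p t γ ε 0 = 0 := by simp [regPrim]

/-- The factored form shows positivity for all `p > 1`; in the definition the second summand is
negative when `p < 2` and `s ≠ 0`. -/
theorem regPowDeriv_eq (hε : 0 < ε) (s : ℝ) :
    regPowDeriv p ε s = ((p - 1) * s ^ 2 + ε) * (s ^ 2 + ε) ^ ((p - 4) / 2) := by
  have hq : 0 < s ^ 2 + ε := by positivity
  rw [regPowDeriv, show (p - 2) / 2 = (p - 4) / 2 + 1 by ring, Real.rpow_add_one hq.ne']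
  ring

theorem regPowDeriv_nonneg (hp : 1 < p) (hε : 0 < ε) (s : ℝ) : 0 ≤ regPowDeriv p ε s := by
  rw [regPowDeriv_eq hε]
  have : 0 < p - 1 := by linarith
  positivity

/-- The function is even, vanishes at `0` and increases on the half-line. A termwise argument fails
because `γ - 2t` may be negative. Nonnegativity is what allows it to be inserted in the weak
divergence inequality. -/
theorem regPrim_nonneg (hp : 1 < p) (ht : 0 ≤ t) (hγ : 0 ≤ γ) (hε : 0 < ε) (s : ℝ) :
    0 ≤ regPrim p t γ ε s := by
  have heven : regPrim p t γ ε s = regPrim p t γ ε |s| := by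
    simp only [regPrim, regPow, sq_abs, ← mul_assoc, abs_mul_abs_self]
  have hmono : MonotoneOn (regPrim p t γ ε) (Ici 0) := by
    refine monotoneOn_of_deriv_nonneg (convex_Ici 0)
      (contDiff_regPrim hε 1).continuous.continuousOn
      ((contDiff_regPrim hε 1).differentiable one_ne_zero).differentiableOn fun x hx => ?_
    rw [interior_Ici] at hx
    have hx' : 0 < x := hx
    rw [(hasDerivAt_regPrim (by linarith) hε x).deriv, regPow]
    have := regPowDeriv_nonneg hp hε x
    positivity
  rw [heven]
  have := hmono (mem_Ici.2 le_rfl) (mem_Ici.2 (abs_nonneg s)) (abs_nonneg s)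
  simpa using this

/-- This and the next two bounds are uniform in `ε ≤ 1` and serve as dominating functions for `ε →
0`. -/
theorem abs_regPow_le (hp : 1 < p) (hε : 0 < ε) (hε1 : ε ≤ 1) (s : ℝ) :
    |regPow p ε s| ≤ (s ^ 2 + 1) ^ ((p - 1) / 2) := by
  have hq : 0 < s ^ 2 + ε := by positivity
  have h1 : |s| ≤ (s ^ 2 + ε) ^ (1 / 2 : ℝ) := by
    rw [← Real.sqrt_eq_rpow]
    exact Real.abs_le_sqrt (by linarith)
  rw [regPow, abs_mul, abs_of_nonneg (Real.rpow_nonneg hq.le _)]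
  calc |s| * (s ^ 2 + ε) ^ ((p - 2) / 2)
      ≤ (s ^ 2 + ε) ^ (1 / 2 : ℝ) * (s ^ 2 + ε) ^ ((p - 2) / 2) := by gcongr
    _ = (s ^ 2 + ε) ^ ((p - 1) / 2) := by rw [← Real.rpow_add hq]; congr 1; ring
    _ ≤ _ := by
      refine Real.rpow_le_rpow hq.le (by linarith) (by linarith)

theorem abs_regPowDeriv_mul_sq_le (hp : 1 < p) (hε : 0 < ε) (hε1 : ε ≤ 1) (s : ℝ) :
    |regPowDeriv p ε s * s ^ 2| ≤ p * (s ^ 2 + 1) ^ (p / 2) := by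
  have hq : 0 < s ^ 2 + ε := by positivity
  have hp1 : 0 < p - 1 := by linarith
  have h0 := regPowDeriv_nonneg hp hε s
  rw [abs_of_nonneg (by positivity), regPowDeriv_eq hε]
  calc ((p - 1) * s ^ 2 + ε) * (s ^ 2 + ε) ^ ((p - 4) / 2) * s ^ 2
      ≤ (p * (s ^ 2 + ε)) * (s ^ 2 + ε) ^ ((p - 4) / 2) * (s ^ 2 + ε) := by
        gcongr
        · nlinarith [sq_nonneg s]
        · linarith
    _ = p * (s ^ 2 + ε) ^ (p / 2) := by
      rw [show p / 2 = (p - 4) / 2 + 1 + 1 by ring, Real.rpow_add_one hq.ne',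
        Real.rpow_add_one hq.ne']
      ring
    _ ≤ _ := by
      gcongr

theorem abs_regPrim_le (hp : 1 < p) (hε : 0 < ε) (hε1 : ε ≤ 1) (s : ℝ) :
    |regPrim p t γ ε s| ≤ |2 * t| * (|s| * (s ^ 2 + 1) ^ ((p - 1) / 2)) +
      |γ - 2 * t| * (((s ^ 2 + 1) ^ (p / 2) + 1) / p) := by
  have hp0 : 0 < p := by linarith
  rw [regPrim]
  refine (abs_add_le _ _).trans ?_
  rw [abs_mul, abs_mul (γ - 2 * t), abs_mul s, abs_div, abs_of_pos hp0]
  have h1 := abs_regPow_le hp hε hε1 s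
  have h2 : |(s ^ 2 + ε) ^ (p / 2) - ε ^ (p / 2)| ≤ (s ^ 2 + 1) ^ (p / 2) + 1 := by
    refine (abs_sub _ _).trans ?_
    rw [abs_of_nonneg (by positivity), abs_of_nonneg (by positivity)]
    gcongr
    exact Real.rpow_le_one hε.le hε1 (by positivity)
  gcongr

theorem tendsto_sq_add_rpow {ε : ℕ → ℝ} (hε : Tendsto ε atTop (𝓝 0)) (r : ℝ) {s : ℝ}
    (hs : s ≠ 0) : Tendsto (fun n => (s ^ 2 + ε n) ^ r) atTop (𝓝 (|s| ^ (2 * r))) := by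
  have h : Tendsto (fun n => s ^ 2 + ε n) atTop (𝓝 (s ^ 2)) := by
    simpa using tendsto_const_nhds.add hε
  have h2 := h.rpow_const (p := r) (Or.inl (by positivity))
  convert h2 using 2
  rw [← sq_abs, Real.rpow_mul (abs_nonneg s), Real.rpow_two]

theorem tendsto_regPow {ε : ℕ → ℝ} (hε : Tendsto ε atTop (𝓝 0)) (s : ℝ) :
    Tendsto (fun n => regPow p (ε n) s) atTop (𝓝 (s * |s| ^ (p - 2))) := by
  rcases eq_or_ne s 0 with rfl | hs
  · simp
  · have := (tendsto_sq_add_rpow hε ((p - 2) / 2) hs).const_mul s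
    rwa [mul_div_cancel₀ _ (two_ne_zero' ℝ)] at this

theorem mul_mul_abs_rpow (hp : 0 < p) (s : ℝ) : s * (s * |s| ^ (p - 2)) = |s| ^ p := by
  rcases eq_or_ne s 0 with rfl | hs
  · simp [Real.zero_rpow hp.ne']
  · have : |s| ^ p = |s| ^ (p - 2) * s ^ 2 := by
      rw [← sq_abs, ← Real.rpow_two, ← Real.rpow_add (abs_pos.2 hs)]; congr 1; ring
    rw [this]; ring

theorem tendsto_regPowDeriv {ε : ℕ → ℝ} (hp : 0 < p) (hε : Tendsto ε atTop (𝓝 0)) (s : ℝ) :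
    Tendsto (fun n => regPowDeriv p (ε n) s * s ^ 2) atTop (𝓝 ((p - 1) * |s| ^ p)) := by
  rcases eq_or_ne s 0 with rfl | hs
  · simp [Real.zero_rpow hp.ne']
  · have h := ((tendsto_sq_add_rpow hε ((p - 2) / 2) hs).add
      ((tendsto_sq_add_rpow hε ((p - 4) / 2) hs).const_mul ((p - 2) * s ^ 2))).mul_const (s ^ 2)
    have e : (p - 1) * |s| ^ p = (|s| ^ (2 * ((p - 2) / 2)) +
        (p - 2) * s ^ 2 * |s| ^ (2 * ((p - 4) / 2))) * s ^ 2 := by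
      have e1 := Real.rpow_add (abs_pos.2 hs) (2 * ((p - 4) / 2)) 2
      rw [Real.rpow_two, sq_abs, show 2 * ((p - 4) / 2) + 2 = p - 2 by ring] at e1
      rw [← mul_mul_abs_rpow hp s, show 2 * ((p - 2) / 2) = p - 2 by ring, e1]
      ring
    rw [e]
    exact h

theorem tendsto_regPrim {ε : ℕ → ℝ} (hp : 0 < p) (hε : Tendsto ε atTop (𝓝 0)) (s : ℝ) :
    Tendsto (fun n => regPrim p t γ (ε n) s) atTop
      (𝓝 (2 * t * |s| ^ p + (γ - 2 * t) * (|s| ^ p / p))) := by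
  rcases eq_or_ne s 0 with rfl | hs
  · simp [Real.zero_rpow hp.ne']
  · have h0 : Tendsto (fun n => ε n ^ (p / 2)) atTop (𝓝 0) := by
      have := hε.rpow_const (p := p / 2) (Or.inr (by positivity))
      rwa [Real.zero_rpow (by positivity)] at this
    have h1 := (((tendsto_regPow (p := p) hε s).const_mul s).const_mul (2 * t)).add
      ((((tendsto_sq_add_rpow hε (p / 2) hs).sub h0).div_const p).const_mul (γ - 2 * t))
    rwa [mul_mul_abs_rpow hp, mul_div_cancel₀ _ (two_ne_zero' ℝ), sub_zero] at h1

end Regularization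

end Rellich

namespace Rellich

open Metric Topology RealInnerProductSpace

/-! ### The operator `H`, integration by parts, and the regularized dual inequality. -/

section Operator

theorem contDiffOn_coeff (δ δ' : ℝ) (n : WithTop ℕ∞) : ContDiffOn ℝ n (coeff δ δ') (Ioi 0) := by
  intro s hs
  have hs' : 0 < s := hs
  refine ContDiffAt.contDiffWithinAt (ContDiffAt.mul ?_ ?_)
  · exact contDiffAt_id.rpow_const_of_ne hs'.ne'
  · exact (contDiffAt_const.add contDiffAt_id).rpow_const_of_ne (by simp; positivity)

/-- Continuity is asked only on the support because powers of the distance can be singular at `K`.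
-/
theorem integrable_of_continuousOn_of_eq_zero {X : Type*} [TopologicalSpace X] [MeasurableSpace X]
    [OpensMeasurableSpace X] {μ : Measure X} [IsFiniteMeasureOnCompacts μ] {S : Set X} {f : X → ℝ}
    (hS : IsCompact S) (hSm : MeasurableSet S) (hf : ContinuousOn f S) (h0 : ∀ x ∉ S, f x = 0) :
    Integrable f μ := by
  rw [← integrableOn_iff_integrable_of_support_subset (s := S)]
  · exact hf.integrableOn_of_subset_isCompact hS hSm Subset.rfl hS.measure_ne_top
  · intro x hx
    by_contra h
    exact hx (h0 x h)

variable {d : ℕ} {K : Set (Space d)} {δ δ' : ℝ}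

theorem bdryDist_eq (K : Set (Space d)) (x : Space d) : bdryDist K x = infDist x K := by
  simp [bdryDist, domain]

theorem tsupport_pderiv_subset (j : Fin d) (φ : Space d → ℝ) :
    tsupport (pderiv j φ) ⊆ tsupport φ := by
  refine closure_minimal (fun x hx => ?_) (isClosed_tsupport φ)
  refine support_fderiv_subset ℝ fun h => hx ?_
  simp only [pderiv, h, zero_apply]

theorem contDiff_pderiv {φ : Space d → ℝ} (hφ : ContDiff ℝ 2 φ) (j : Fin d) :
    ContDiff ℝ 1 (pderiv j φ) :=
  (hφ.fderiv_right (m := 1) (by norm_num)).clm_apply contDiff_const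

theorem sum_mul_pderiv (f : Space d → ℝ) (x v : Space d) :
    ∑ j, pderiv j f x * v j = fderiv ℝ f x v := by
  have h : v = ∑ j, v j • EuclideanSpace.single j (1 : ℝ) := by
    simpa using ((EuclideanSpace.basisFun (Fin d) ℝ).sum_repr v).symm
  have := congrArg (fderiv ℝ f x) h
  rw [this, map_sum]
  simp [pderiv, mul_comm]

variable {P : Space d → Space d} (hP : IsNearestPointMap K P) (hK : IsClosed K)
include hP hK

theorem contDiff_weight_mul_pderiv {φ : Space d → ℝ} (hφ : IsTest (domain K) φ) (j : Fin d) :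
    ContDiff ℝ 1 fun y => weight δ δ' K y * pderiv j φ y := by
  refine contDiff_mul_of_tsupport_subset hK.isOpen_compl (f := weight δ δ' K) ?_
    (contDiff_pderiv hφ.1 j) ((tsupport_pderiv_subset j φ).trans hφ.2.2)
  have := hP.contDiffOn_comp_infDist hK (contDiffOn_coeff δ δ' 1)
  exact this.congr fun x _ => by rw [weight, bdryDist_eq]

omit hP hK in
theorem hasCompactSupport_weight_mul_pderiv {φ : Space d → ℝ} (hφ : IsTest (domain K) φ)
    (j : Fin d) : HasCompactSupport fun y => weight δ δ' K y * pderiv j φ y :=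
  HasCompactSupport.mul_left (hφ.2.1.of_isClosed_subset (isClosed_tsupport _)
    (tsupport_pderiv_subset j φ))

theorem continuous_H {φ : Space d → ℝ} (hφ : IsTest (domain K) φ) : Continuous (H δ δ' K φ) := by
  refine (continuous_finsetSum _ fun j _ => ?_).neg
  exact ((contDiff_weight_mul_pderiv hP hK hφ j).continuous_fderiv one_ne_zero).clm_apply
    continuous_const

omit hP hK in
theorem H_eq_zero_of_notMem_tsupport {φ : Space d → ℝ} {x : Space d} (hx : x ∉ tsupport φ) :
    H δ δ' K φ x = 0 := by
  rw [H, neg_eq_zero]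
  refine Finset.sum_eq_zero fun j _ => ?_
  have h : (fun y => weight δ δ' K y * pderiv j φ y) =ᶠ[𝓝 x] fun _ => 0 := by
    have := notMem_tsupport_iff_eventuallyEq.1 fun h => hx (tsupport_pderiv_subset j φ h)
    filter_upwards [this] with y hy
    simp [hy]
  rw [pderiv, h.fderiv_eq]
  simp

/-- Integration by parts in `∫ (H φ) v`. -/
theorem integral_H_mul {φ v : Space d → ℝ} (hφ : IsTest (domain K) φ) (hv : ContDiff ℝ 1 v)
    (hvc : HasCompactSupport v) :
    ∫ x, H δ δ' K φ x * v x = ∫ x, weight δ δ' K x * ∑ j, pderiv j φ x * pderiv j v x := by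
  obtain ⟨C, hC⟩ := hv.lipschitzWith_of_hasCompactSupport hvc one_ne_zero
  have h1 : ∀ j, ∫ x, v x * pderiv j (fun y => weight δ δ' K y * pderiv j φ y) x =
      -∫ x, pderiv j v x * (weight δ δ' K x * pderiv j φ x) := by
    intro j
    have := integral_mul_fderiv_eq_neg_lineDeriv hC
      (contDiff_weight_mul_pderiv (δ := δ) (δ' := δ') hP hK hφ j)
      (hasCompactSupport_weight_mul_pderiv hφ j) (EuclideanSpace.single j 1)
    simp only [pderiv] at this ⊢
    rw [this]
    congr 1
    refine integral_congr_ae (Eventually.of_forall fun x => ?_)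
    simp only
    rw [(hv.differentiable one_ne_zero x).lineDeriv_eq_fderiv]
  have i1 : ∀ j, Integrable fun x =>
      v x * pderiv j (fun y => weight δ δ' K y * pderiv j φ y) x := fun j =>
    Continuous.integrable_of_hasCompactSupport (hv.continuous.mul
      (((contDiff_weight_mul_pderiv hP hK hφ j).continuous_fderiv one_ne_zero).clm_apply
        continuous_const)) hvc.mul_right
  have cv : ∀ j, Continuous (pderiv j v) := fun j =>
    (hv.continuous_fderiv one_ne_zero).clm_apply continuous_const
  have i2 : ∀ j, Integrable fun x =>
      pderiv j v x * (weight δ δ' K x * pderiv j φ x) := fun j =>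
    Continuous.integrable_of_hasCompactSupport ((cv j).mul
      (contDiff_weight_mul_pderiv hP hK hφ j).continuous)
      (hasCompactSupport_weight_mul_pderiv hφ j).mul_left
  calc ∫ x, H δ δ' K φ x * v x
      = -∫ x, ∑ j, v x * pderiv j (fun y => weight δ δ' K y * pderiv j φ y) x := by
        rw [← integral_neg]
        refine integral_congr_ae (Eventually.of_forall fun x => ?_)
        simp only [H, neg_mul, Finset.sum_mul]
        exact congrArg _ (Finset.sum_congr rfl fun j _ => mul_comm _ _)
    _ = ∫ x, ∑ j, pderiv j v x * (weight δ δ' K x * pderiv j φ x) := by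
        rw [integral_finsetSum _ fun j _ => i1 j, integral_finsetSum _ fun j _ => i2 j,
          ← Finset.sum_neg_distrib]
        exact Finset.sum_congr rfl fun j _ => by rw [h1, neg_neg]
    _ = _ := by
        refine integral_congr_ae (Eventually.of_forall fun x => ?_)
        simp only [Finset.mul_sum]
        exact Finset.sum_congr rfl fun j _ => by ring

omit hP hK in
theorem weight_self (x : Space d) : weight δ δ K x = infDist x K ^ δ := by
  simp [weight, coeff, bdryDist_eq]

omit hP hK in
theorem tsupport_comp_subset_of_zero {f : ℝ → ℝ} (hf : f 0 = 0) (φ : Space d → ℝ) :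
    tsupport (fun x => f (φ x)) ⊆ tsupport φ :=
  closure_mono (Function.support_comp_subset hf φ)

/-- The integrated Rellich identity with the test function `F(φ) d^μ`, where `F` is a
regularization of `|s|^(p - 2) s`. -/
theorem regularized_le_integral_H_mul {p t ε : ℝ} (hp : 1 < p) (hδ : δ ≤ 2) (ht : 0 ≤ t)
    (hε : 0 < ε) {φ : Space d → ℝ} (hφ : IsTest (domain K) φ) :
    ((δ - 2) * p + d - dim K) * (∫ x, infDist x K ^ ((δ - 2) * p) *
        regPrim p t ((2 - δ) * (p - 1)) ε (φ x)) -
      t ^ 2 * (∫ x, infDist x K ^ ((δ - 2) * p) * (regPowDeriv p ε (φ x) * φ x ^ 2)) ≤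
      ∫ x, H δ δ K φ x * (infDist x K ^ ((δ - 2) * (p - 1)) * regPow p ε (φ x)) := by
  set r := (δ - 2) * p with hr
  -- With this exponent both terms of `d^δ ∇φ · ∇(d^μ F(φ))` carry the same power `d^r`, and `μ =
  -- -γ`.
  set μ := (δ - 2) * (p - 1) with hμ
  set γ := (2 - δ) * (p - 1) with hγ
  have hγ0 : 0 ≤ γ := mul_nonneg (by linarith) (by linarith)
  have hφ1 : ContDiff ℝ 1 φ := hφ.1.of_le (by norm_num)
  set F := fun x => regPow p ε (φ x)
  set G := fun x => regPrim p t γ ε (φ x)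
  have hF : ContDiff ℝ 1 F := (contDiff_regPow hε 1).comp hφ1
  have hG : ContDiff ℝ 1 G := (contDiff_regPrim hε 1).comp hφ1
  have hFs : tsupport F ⊆ tsupport φ := tsupport_comp_subset_of_zero regPow_zero φ
  have hGs : tsupport G ⊆ tsupport φ := tsupport_comp_subset_of_zero regPrim_zero φ
  have hFc : HasCompactSupport F := hφ.2.1.of_isClosed_subset (isClosed_tsupport _) hFs
  have hGc : HasCompactSupport G := hφ.2.1.of_isClosed_subset (isClosed_tsupport _) hGs
  have hΩ : tsupport φ ⊆ Kᶜ := hφ.2.2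
  have hv : ContDiff ℝ 1 fun x => infDist x K ^ μ * F x :=
    contDiff_mul_of_tsupport_subset hK.isOpen_compl (hP.contDiffOn_infDist_rpow hK μ) hF
      (hFs.trans hΩ)
  have hvc : HasCompactSupport fun x => infDist x K ^ μ * F x := hFc.mul_left
  have hfin : (Module.finrank ℝ (Space d) : ℝ) = d := by simp
  have key := hP.integral_infDist_rpow_le hK r hG hGc (hGs.trans hΩ)
    fun x => regPrim_nonneg hp ht hγ0 hε (φ x)
  rw [hfin] at key
  rw [integral_H_mul hP hK hφ hv hvc]
  have hcr : ContinuousOn (fun x => infDist x K ^ r) (tsupport φ) :=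
    (hP.contDiffOn_infDist_rpow hK r).continuousOn.mono hΩ
  have hS : IsCompact (tsupport φ) := hφ.2.1
  have hSm : MeasurableSet (tsupport φ) := (isClosed_tsupport φ).measurableSet
  have hφ0 : ∀ x ∉ tsupport φ, φ x = 0 := fun x hx => image_eq_zero_of_notMem_tsupport hx
  have hfφ0 : ∀ x ∉ tsupport φ, fderiv ℝ φ x = 0 := fun x hx => by
    by_contra h
    exact hx (support_fderiv_subset ℝ h)
  have hfG : ∀ x, fderiv ℝ G x = (2 * t * φ x * regPowDeriv p ε (φ x) + γ * regPow p ε (φ x)) •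
      fderiv ℝ φ x := fun x =>
    ((hasDerivAt_regPrim (by linarith) hε (φ x)).comp_hasFDerivAt x
      (hφ1.differentiable one_ne_zero x).hasFDerivAt).fderiv
  have i1 : Integrable fun x => infDist x K ^ r * fderiv ℝ G x (x - P x) := by
    refine integrable_of_continuousOn_of_eq_zero hS hSm (hcr.mul ?_) fun x hx => ?_
    · exact ((hG.continuous_fderiv one_ne_zero).clm_apply
        (continuous_id.sub hP.lipschitz.continuous)).continuousOn
    · rw [hfG, hfφ0 x hx]; simp
  have i2 : Integrable fun x => infDist x K ^ r * (regPowDeriv p ε (φ x) * φ x ^ 2) := by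
    refine integrable_of_continuousOn_of_eq_zero hS hSm (hcr.mul ?_) fun x hx => ?_
    · exact (((continuous_regPowDeriv hε).comp hφ1.continuous).mul
        (hφ1.continuous.pow 2)).continuousOn
    · rw [hφ0 x hx]; simp
  have i3 : Integrable fun x => weight δ δ K x *
      ∑ j, pderiv j φ x * pderiv j (fun x => infDist x K ^ μ * F x) x := by
    simp only [weight_self]
    refine integrable_of_continuousOn_of_eq_zero hS hSm (ContinuousOn.mul
      ((hP.contDiffOn_infDist_rpow hK δ).continuousOn.mono hΩ) ?_) fun x hx => ?_
    · refine Continuous.continuousOn (continuous_finsetSum _ fun j _ => ?_)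
      exact (contDiff_pderiv hφ.1 j).continuous.mul
        ((hv.continuous_fderiv one_ne_zero).clm_apply continuous_const)
    · simp [pderiv, hfφ0 x hx]
  -- The right side is `d^r (F' |∇φ|² d² - γ F n)` with `n = ∇φ · (x - P x)`. Cauchy–Schwarz and `(n
  -- + tφ)² ≥ 0` make it at least `d^r (-(2tφF' + γF) n - t² F' φ²)`, and `(2tφF' + γF) n` is the
  -- derivative of `G` along `x - P x`.
  have hpt : ∀ x, -(infDist x K ^ r * fderiv ℝ G x (x - P x)) -
      t ^ 2 * (infDist x K ^ r * (regPowDeriv p ε (φ x) * φ x ^ 2)) ≤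
      weight δ δ K x * ∑ j, pderiv j φ x * pderiv j (fun x => infDist x K ^ μ * F x) x := by
    intro x
    by_cases hx : x ∈ tsupport φ
    · have hxK := hΩ hx
      have hpos := hP.infDist_pos hK hxK
      set D := infDist x K
      set n := fderiv ℝ φ x (x - P x)
      set S := ∑ j, pderiv j φ x ^ 2
      have hn : n = ∑ j, pderiv j φ x * (x - P x) j := (sum_mul_pderiv φ x (x - P x)).symm
      have hD2 : D ^ 2 = ∑ j, (x - P x) j ^ 2 := by
        rw [← EuclideanSpace.real_norm_sq_eq, hP.norm_sub]
      have hCS : n ^ 2 ≤ S * D ^ 2 := by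
        rw [hn, hD2]
        exact Finset.sum_mul_sq_le_sq_mul_sq _ _ _
      have hdF : HasFDerivAt F (regPowDeriv p ε (φ x) • fderiv ℝ φ x) x :=
        (hasDerivAt_regPow hε (φ x)).comp_hasFDerivAt x
          (hφ1.differentiable one_ne_zero x).hasFDerivAt
      have hdv := ((hP.hasFDerivAt_infDist_rpow hK μ hxK).fun_mul hdF).fderiv
      have hpv : ∀ j, pderiv j (fun x => infDist x K ^ μ * F x) x =
          D ^ μ * regPowDeriv p ε (φ x) * pderiv j φ x +
            regPow p ε (φ x) * (μ * D ^ (μ - 2)) * (x - P x) j := by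
        intro j
        simp only [pderiv]
        rw [hdv]
        have : innerSL ℝ (x - P x) (EuclideanSpace.single j 1) = (x - P x) j := by
          rw [innerSL_apply_apply, EuclideanSpace.inner_single_right]
          simp
        simp only [add_apply, smul_apply, smul_eq_mul, this]
        simp only [F, D]
        ring
      have hsum : ∑ j, pderiv j φ x * pderiv j (fun x => infDist x K ^ μ * F x) x =
          D ^ μ * regPowDeriv p ε (φ x) * S + regPow p ε (φ x) * (μ * D ^ (μ - 2)) * n := by
        rw [hn, Finset.mul_sum, Finset.mul_sum, ← Finset.sum_add_distrib]
        exact Finset.sum_congr rfl fun j _ => by rw [hpv]; ring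
      rw [hsum, weight_self, hfG]
      have e1 : D ^ δ * D ^ μ = D ^ r * D ^ 2 := by
        rw [← Real.rpow_two, ← Real.rpow_add hpos, ← Real.rpow_add hpos]; congr 1; rw [hμ, hr]; ring
      have e2 : D ^ δ * D ^ (μ - 2) = D ^ r := by
        rw [← Real.rpow_add hpos]; congr 1; rw [hμ, hr]; ring
      have e3 : μ = -γ := by rw [hμ, hγ]; ring
      have hF' := regPowDeriv_nonneg hp hε (φ x)
      set f' := regPowDeriv p ε (φ x)
      set f := regPow p ε (φ x)
      have hDr : 0 ≤ D ^ r := Real.rpow_nonneg hpos.le _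
      have hn' : fderiv ℝ φ x (x - P x) = n := rfl
      rw [smul_apply, smul_eq_mul, hn']
      have e4 : D ^ δ * (D ^ μ * f' * S + f * (μ * D ^ (μ - 2)) * n) =
          D ^ r * (f' * (S * D ^ 2) - γ * f * n) := by
        linear_combination f' * S * e1 + f * μ * n * e2 + D ^ r * f * n * e3
      rw [e4]
      have h1 : 0 ≤ D ^ r * (f' * (S * D ^ 2 - n ^ 2)) :=
        mul_nonneg hDr (mul_nonneg hF' (by linarith))
      have h2 : 0 ≤ D ^ r * (f' * (n + t * φ x) ^ 2) := by positivity
      linarith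
    · rw [hfG, hfφ0 x hx, hφ0 x hx]
      simp [pderiv, hfφ0 x hx]
  have hmono := integral_mono (i1.neg.sub (i2.const_mul (t ^ 2))) i3 hpt
  have e : ∫ x, ((-fun x => infDist x K ^ r * fderiv ℝ G x (x - P x)) -
      fun x => t ^ 2 * (infDist x K ^ r * (regPowDeriv p ε (φ x) * φ x ^ 2))) x =
      -(∫ x, infDist x K ^ r * fderiv ℝ G x (x - P x)) -
      t ^ 2 * ∫ x, infDist x K ^ r * (regPowDeriv p ε (φ x) * φ x ^ 2) := by
    rw [integral_sub' i1.neg (i2.const_mul (t ^ 2)), integral_const_mul, integral_neg']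
  rw [e] at hmono
  refine le_trans ?_ hmono
  exact sub_le_sub_right key _

end Operator

end Rellich

/-! ### The Rellich inequality, that is, the lower bound for the constant. -/

namespace Rellich

open Metric Topology RealInnerProductSpace

/-- Young's inequality applied to `(f / C) · g^(p-1)`: scaling by `C` gives the sharp power without
dividing by an integral that might vanish. -/
theorem rpow_mul_le_of_mul_le_integral_mul {X : Type*} [MeasurableSpace X] {μ : Measure X}
    {p C : ℝ} (hp : 1 < p) (hC : 0 < C) {f g : X → ℝ} (hf : ∀ x, 0 ≤ f x) (hg : ∀ x, 0 ≤ g x)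
    (hfi : Integrable (fun x => f x ^ p) μ) (hgi : Integrable (fun x => g x ^ p) μ)
    (h : C * ∫ x, g x ^ p ∂μ ≤ ∫ x, f x * g x ^ (p - 1) ∂μ) :
    C ^ p * ∫ x, g x ^ p ∂μ ≤ ∫ x, f x ^ p ∂μ := by
  have hp0 : 0 < p := by linarith
  have hpq : p.HolderConjugate (p / (p - 1)) := Real.HolderConjugate.conjExponent hp
  have hCp : 0 < C ^ p := Real.rpow_pos_of_pos hC p
  have hpt : ∀ x, f x * g x ^ (p - 1) ≤
      C * (f x ^ p / C ^ p / p) + C * (g x ^ p / (p / (p - 1))) := by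
    intro x
    have hy := Real.young_inequality_of_nonneg (div_nonneg (hf x) hC.le)
      (Real.rpow_nonneg (hg x) (p - 1)) hpq
    rw [← Real.rpow_mul (hg x), mul_div_cancel₀ _ (by linarith : p - 1 ≠ 0),
      Real.div_rpow (hf x) hC.le] at hy
    calc f x * g x ^ (p - 1) = C * (f x / C * g x ^ (p - 1)) := by field_simp
      _ ≤ C * (f x ^ p / C ^ p / p + g x ^ p / (p / (p - 1))) := by gcongr
      _ = _ := by ring
  have i1 : Integrable (fun x => C * (f x ^ p / C ^ p / p)) μ :=
    ((hfi.div_const _).div_const _).const_mul _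
  have i2 : Integrable (fun x => C * (g x ^ p / (p / (p - 1)))) μ :=
    (hgi.div_const _).const_mul _
  have hle : ∫ x, f x * g x ^ (p - 1) ∂μ ≤
      ∫ x, (C * (f x ^ p / C ^ p / p) + C * (g x ^ p / (p / (p - 1)))) ∂μ :=
    integral_mono_of_nonneg
      (Eventually.of_forall fun x => mul_nonneg (hf x) (Real.rpow_nonneg (hg x) _)) (i1.add i2)
      (Eventually.of_forall hpt)
  rw [integral_add i1 i2, integral_const_mul, integral_const_mul, integral_div, integral_div,
    integral_div] at hle
  have h1 := h.trans hle
  rw [← mul_add, mul_le_mul_iff_right₀ hC] at h1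
  set N := ∫ x, f x ^ p ∂μ
  set G := ∫ x, g x ^ p ∂μ
  have h2 : G / (p / (p - 1)) = G - G / p := by
    have : p - 1 ≠ 0 := by linarith
    field_simp
  rw [h2] at h1
  have h3 : G / p ≤ N / C ^ p / p := by linarith
  have h4 : G ≤ N / C ^ p := (div_le_div_iff_of_pos_right hp0).1 h3
  rw [le_div_iff₀ hCp] at h4
  linarith

variable {d : ℕ} {K : Set (Space d)} {δ : ℝ} {P : Space d → Space d}

/-- The dual form of the Rellich inequality. -/
theorem mul_integral_le_integral_H_mul (hP : IsNearestPointMap K P) (hK : IsClosed K) {p : ℝ}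
    (hp : 1 < p) (hδ : δ ≤ 2) (hA : 0 ≤ (d : ℝ) - dim K + p * δ - 2 * p) {φ : Space d → ℝ}
    (hφ : IsTest (domain K) φ) :
    (p - 1) * ((d : ℝ) - dim K) * ((d : ℝ) - dim K + p * δ - 2 * p) / p ^ 2 *
        ∫ x, infDist x K ^ ((δ - 2) * p) * |φ x| ^ p ≤
      ∫ x, H δ δ K φ x * (infDist x K ^ ((δ - 2) * (p - 1)) * (φ x * |φ x| ^ (p - 2))) := by
  have hp0 : 0 < p := by linarith
  set A := (d : ℝ) - dim K + p * δ - 2 * p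
  -- The maximizer of the limiting coefficient `A (2t + (γ - 2t)/p) - t² (p - 1)`, whose maximum is
  -- `(p-1)(d-k)A/p²`.
  set t := A / p with ht
  have ht0 : 0 ≤ t := div_nonneg hA hp0.le
  set γ := (2 - δ) * (p - 1) with hγ
  set r := (δ - 2) * p
  set μ := (δ - 2) * (p - 1)
  have hφc : Continuous φ := hφ.1.continuous
  have hΩ : tsupport φ ⊆ Kᶜ := hφ.2.2
  have hS : IsCompact (tsupport φ) := hφ.2.1
  have hSm : MeasurableSet (tsupport φ) := (isClosed_tsupport φ).measurableSet
  have hφ0 : ∀ x ∉ tsupport φ, φ x = 0 := fun x hx => image_eq_zero_of_notMem_tsupport hx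
  have hcr : ∀ r : ℝ, ContinuousOn (fun x => infDist x K ^ r) (tsupport φ) := fun r =>
    (hP.contDiffOn_infDist_rpow hK r).continuousOn.mono hΩ
  let ε : ℕ → ℝ := fun n => 1 / ((n : ℝ) + 1)
  have hε : Tendsto ε atTop (𝓝 0) := tendsto_one_div_add_atTop_nhds_zero_nat
  have hε0 : ∀ n, 0 < ε n := fun n => by positivity
  have hε1 : ∀ n, ε n ≤ 1 := fun n => by
    simp only [ε]
    rw [div_le_one (by positivity)]
    linarith [(Nat.cast_nonneg n : (0 : ℝ) ≤ n)]
  -- Dominated convergence on the compact support of `φ`, stated once for the three integrals in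
  -- which `ε` occurs.
  have hconv : ∀ (f : Space d → ℝ) (F : ℕ → ℝ → ℝ) (F₀ B : ℝ → ℝ),
      ContinuousOn f (tsupport φ) → (∀ n, Continuous (F n)) → Continuous B →
      (∀ n s, |F n s| ≤ B s) → (∀ s, Tendsto (fun n => F n s) atTop (𝓝 (F₀ s))) →
      (∀ n, F n 0 = 0) →
      Tendsto (fun n => ∫ x, f x * F n (φ x)) atTop (𝓝 (∫ x, f x * F₀ (φ x))) := by
    intro f F F₀ B hf hF hB hFB hlim hF0
    have hF₀ : F₀ 0 = 0 := tendsto_nhds_unique (hlim 0) (by simp [hF0])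
    have e : ∀ G : ℝ → ℝ, G 0 = 0 → ∫ x, f x * G (φ x) = ∫ x in tsupport φ, f x * G (φ x) := by
      intro G hG
      exact (setIntegral_eq_integral_of_forall_compl_eq_zero fun x hx => by
        rw [hφ0 x hx, hG, mul_zero]).symm
    rw [e F₀ hF₀]
    simp_rw [fun n => e (F n) (hF0 n)]
    refine tendsto_integral_filter_of_dominated_convergence (fun x => |f x| * B (φ x)) ?_ ?_ ?_ ?_
    · exact Eventually.of_forall fun n =>
        (hf.mul ((hF n).comp hφc).continuousOn).aestronglyMeasurable hSm
    · refine Eventually.of_forall fun n => Eventually.of_forall fun x => ?_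
      rw [norm_mul]
      exact mul_le_mul_of_nonneg_left (hFB n _) (abs_nonneg _)
    · exact (hf.abs.mul (hB.comp hφc).continuousOn).integrableOn_of_subset_isCompact hS hSm
        Subset.rfl hS.measure_ne_top
    · exact Eventually.of_forall fun x => (hlim _).const_mul _
  have cB : ∀ q : ℝ, Continuous fun s : ℝ => (s ^ 2 + 1) ^ q := fun q =>
    (contDiff_sq_add_rpow one_pos q 0).continuous
  have l1 := hconv (fun x => infDist x K ^ r) (fun n => regPrim p t γ (ε n)) _ _ (hcr r)
    (fun n => (contDiff_regPrim (hε0 n) 0).continuous)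
    (by
      refine Continuous.add (continuous_const.mul (continuous_abs.mul (cB _)))
        (continuous_const.mul (((cB _).add continuous_const).div_const p)))
    (fun n s => abs_regPrim_le hp (hε0 n) (hε1 n) s) (fun s => tendsto_regPrim hp0 hε s)
    (fun n => regPrim_zero)
  have l2 := hconv (fun x => infDist x K ^ r) (fun n s => regPowDeriv p (ε n) s * s ^ 2) _ _ (hcr r)
    (fun n => (continuous_regPowDeriv (hε0 n)).mul (continuous_pow 2))
    (continuous_const.mul (cB _))
    (fun n s => abs_regPowDeriv_mul_sq_le hp (hε0 n) (hε1 n) s)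
    (fun s => tendsto_regPowDeriv hp0 hε s) (fun n => by simp)
  have l3 := hconv (fun x => H δ δ K φ x * infDist x K ^ μ) (fun n => regPow p (ε n)) _ _
    ((continuous_H hP hK hφ).continuousOn.mul (hcr μ))
    (fun n => (contDiff_regPow (hε0 n) 0).continuous) (cB _)
    (fun n s => abs_regPow_le hp (hε0 n) (hε1 n) s) (fun s => tendsto_regPow hε s)
    (fun n => regPow_zero)
  simp only [mul_assoc] at l3
  have hle := le_of_tendsto_of_tendsto ((l1.const_mul (r + d - dim K)).sub (l2.const_mul (t ^ 2))) l3
    (Eventually.of_forall fun n => regularized_le_integral_H_mul hP hK hp hδ ht0 (hε0 n) hφ)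
  refine le_trans (le_of_eq ?_) hle
  have e1 : ∫ x, infDist x K ^ r * (2 * t * |φ x| ^ p + (γ - 2 * t) * (|φ x| ^ p / p)) =
      (2 * t + (γ - 2 * t) / p) * ∫ x, infDist x K ^ r * |φ x| ^ p := by
    rw [← integral_const_mul]
    congr 1
    ext x
    ring
  have e2 : ∫ x, infDist x K ^ r * ((p - 1) * |φ x| ^ p) =
      (p - 1) * ∫ x, infDist x K ^ r * |φ x| ^ p := by
    rw [← integral_const_mul]
    congr 1
    ext x
    ring
  rw [e1, e2, ← mul_assoc, ← mul_assoc, ← sub_mul]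
  congr 1
  simp only [ht, hγ, r, A]
  field_simp
  ring

/-- The Rellich inequality for the weight `d^δ`, `δ ≤ 2`. -/
theorem rpow_mul_integral_le_integral_abs_H_rpow (hP : IsNearestPointMap K P) (hK : IsClosed K)
    {p : ℝ} (hp : 1 < p) (hδ : δ ≤ 2) (hA : 0 < (d : ℝ) - dim K + p * δ - 2 * p)
    (hd : (0 : ℝ) < (d : ℝ) - dim K) {φ : Space d → ℝ} (hφ : IsTest (domain K) φ) :
    ((p - 1) * ((d : ℝ) - dim K) * ((d : ℝ) - dim K + p * δ - 2 * p) / p ^ 2) ^ p *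
        ∫ x in domain K, |weight δ δ K x / bdryDist K x ^ 2 * φ x| ^ p ≤
      ∫ x in domain K, |H δ δ K φ x| ^ p := by
  have hp0 : 0 < p := by linarith
  have hp1 : 0 < p - 1 := by linarith
  have hΩ : tsupport φ ⊆ Kᶜ := hφ.2.2
  have hS : IsCompact (tsupport φ) := hφ.2.1
  have hSm : MeasurableSet (tsupport φ) := (isClosed_tsupport φ).measurableSet
  have hφ0 : ∀ x ∉ tsupport φ, φ x = 0 := fun x hx => image_eq_zero_of_notMem_tsupport hx
  have hcr : ∀ r : ℝ, ContinuousOn (fun x => infDist x K ^ r) (tsupport φ) := fun r =>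
    (hP.contDiffOn_infDist_rpow hK r).continuousOn.mono hΩ
  set g : Space d → ℝ := fun x => infDist x K ^ (δ - 2) * |φ x| with hg
  have hg0 : ∀ x, 0 ≤ g x := fun x =>
    mul_nonneg (Real.rpow_nonneg infDist_nonneg _) (abs_nonneg _)
  have hgp : ∀ x, g x ^ p = infDist x K ^ ((δ - 2) * p) * |φ x| ^ p := fun x => by
    rw [hg]
    simp only
    rw [Real.mul_rpow (Real.rpow_nonneg infDist_nonneg _) (abs_nonneg _),
      ← Real.rpow_mul infDist_nonneg]
  have hgi : Integrable fun x => g x ^ p := by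
    refine integrable_of_continuousOn_of_eq_zero hS hSm
      (ContinuousOn.rpow_const ((hcr _).mul hφ.1.continuous.abs.continuousOn)
        fun x _ => Or.inr hp0.le) fun x hx => ?_
    simp [hg, hφ0 x hx, Real.zero_rpow hp0.ne']
  have hfi : Integrable fun x => |H δ δ K φ x| ^ p := by
    refine integrable_of_continuousOn_of_eq_zero hS hSm
      (ContinuousOn.rpow_const (continuous_H hP hK hφ).abs.continuousOn
        fun x _ => Or.inr hp0.le) fun x hx => ?_
    simp [H_eq_zero_of_notMem_tsupport hx, Real.zero_rpow hp0.ne']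
  have hdual := mul_integral_le_integral_H_mul hP hK hp hδ hA.le hφ
  simp_rw [← hgp] at hdual
  have hle : ∫ x, H δ δ K φ x * (infDist x K ^ ((δ - 2) * (p - 1)) * (φ x * |φ x| ^ (p - 2))) ≤
      ∫ x, |H δ δ K φ x| * g x ^ (p - 1) := by
    have hpt : ∀ x, |H δ δ K φ x *
        (infDist x K ^ ((δ - 2) * (p - 1)) * (φ x * |φ x| ^ (p - 2)))| =
        |H δ δ K φ x| * g x ^ (p - 1) := by
      intro x
      rw [abs_mul, hg]
      simp only
      rw [Real.mul_rpow (Real.rpow_nonneg infDist_nonneg _) (abs_nonneg _),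
        ← Real.rpow_mul infDist_nonneg, abs_mul, abs_mul,
        abs_of_nonneg (Real.rpow_nonneg infDist_nonneg _),
        abs_of_nonneg (Real.rpow_nonneg (abs_nonneg _) _)]
      congr 2
      rcases eq_or_ne (φ x) 0 with h | h
      · simp [h, Real.zero_rpow hp1.ne']
      · rw [← Real.rpow_one_add' (abs_nonneg _) (by linarith)]
        congr 1
        ring
    refine (le_abs_self _).trans ((abs_integral_le_integral_abs).trans (le_of_eq ?_))
    simp_rw [hpt]
  have hC : 0 < (p - 1) * ((d : ℝ) - dim K) * ((d : ℝ) - dim K + p * δ - 2 * p) / p ^ 2 := by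
    positivity
  have := rpow_mul_le_of_mul_le_integral_mul hp hC (fun x => abs_nonneg _) hg0 hfi hgi
    (hdual.trans hle)
  rw [setIntegral_eq_integral_of_forall_compl_eq_zero (fun x hx => by
      rw [hφ0 x fun h => hx (hΩ h), mul_zero, abs_zero, Real.zero_rpow hp0.ne']),
    setIntegral_eq_integral_of_forall_compl_eq_zero (fun x hx => by
      rw [H_eq_zero_of_notMem_tsupport fun h => hx (hΩ h), abs_zero, Real.zero_rpow hp0.ne'])]
  convert this using 3
  ext x
  congr 1
  by_cases hx : x ∈ tsupport φ
  · have hpos := hP.infDist_pos hK (hΩ hx)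
    rw [weight_self, bdryDist_eq, abs_mul, hg]
    simp only
    rw [Real.rpow_sub hpos, Real.rpow_two, abs_of_pos (by positivity)]
  · simp [hg, hφ0 x hx]

/-- Without positivity the quotient could be `0` by the convention for division by zero. -/
theorem integral_weight_div_sq_mul_pos (hP : IsNearestPointMap K P) (hK : IsClosed K) (δ δ' : ℝ)
    {p : ℝ} (hp : 0 < p) {φ : Space d → ℝ} (hφ : IsTest (domain K) φ) (hne : φ ≠ 0) :
    0 < ∫ x in domain K, |weight δ δ' K x / bdryDist K x ^ 2 * φ x| ^ p := by
  have hΩ : tsupport φ ⊆ Kᶜ := hφ.2.2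
  have hφ0 : ∀ x ∉ tsupport φ, φ x = 0 := fun x hx => image_eq_zero_of_notMem_tsupport hx
  rw [setIntegral_eq_integral_of_forall_compl_eq_zero (fun x hx => by
      rw [hφ0 x fun h => hx (hΩ h), mul_zero, abs_zero, Real.zero_rpow hp.ne'])]
  have hw : ContinuousOn (weight δ δ' K) (tsupport φ) :=
    ((hP.contDiffOn_comp_infDist hK (contDiffOn_coeff δ δ' 1)).continuousOn.mono hΩ).congr
      fun x _ => by rw [weight, bdryDist_eq]
  have hD : ContinuousOn (fun x => bdryDist K x ^ 2) (tsupport φ) := by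
    simp only [bdryDist_eq]
    exact ((continuous_infDist_pt K).pow 2).continuousOn
  have hpos : ∀ x ∈ tsupport φ, 0 < bdryDist K x := fun x hx => by
    rw [bdryDist_eq]
    exact hP.infDist_pos hK (hΩ hx)
  rw [integral_pos_iff_support_of_nonneg (fun x => Real.rpow_nonneg (abs_nonneg _) _)]
  · obtain ⟨x, hx⟩ := Function.ne_iff.1 hne
    have hopen : IsOpen (Function.support φ) := hφ.1.continuous.isOpen_support
    refine (hopen.measure_pos volume ⟨x, hx⟩).trans_le (measure_mono fun y hy => ?_)
    have hD := hpos y (subset_tsupport φ hy)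
    have hwy : 0 < weight δ δ' K y := by
      rw [weight, coeff]
      positivity
    have hy' : φ y ≠ 0 := hy
    rw [Function.mem_support]
    exact (Real.rpow_pos_of_pos (abs_pos.2 (by positivity)) p).ne'
  · refine integrable_of_continuousOn_of_eq_zero hφ.2.1 (isClosed_tsupport φ).measurableSet
      (ContinuousOn.rpow_const ((hw.div hD fun x hx => (pow_pos (hpos x hx) 2).ne').mul
        hφ.1.continuous.continuousOn).abs fun x _ => Or.inr hp.le) fun x hx => ?_
    rw [hφ0 x hx, mul_zero, abs_zero, Real.zero_rpow hp.ne']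

theorem bddBelow_quotients (p δ δ' : ℝ) (K : Set (Space d)) :
    (0 : ℝ) ∈ lowerBounds {r : ℝ | ∃ φ : Space d → ℝ, IsTest (domain K) φ ∧ φ ≠ 0 ∧
      r = (∫ x in domain K, |H δ δ' K φ x| ^ p) /
        ∫ x in domain K, |weight δ δ' K x / bdryDist K x ^ 2 * φ x| ^ p} := by
  rintro r ⟨φ, -, -, rfl⟩
  exact div_nonneg (integral_nonneg fun x => Real.rpow_nonneg (abs_nonneg _) _)
    (integral_nonneg fun x => Real.rpow_nonneg (abs_nonneg _) _)

end Rellich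

namespace Rellich

open Metric Topology RealInnerProductSpace

/-! ### Functions of the two components along a subspace and its orthogonal complement. -/

section Cylindrical

variable {E : Type*} [NormedAddCommGroup E] [InnerProductSpace ℝ E] [FiniteDimensional ℝ E]

/-- The norm of the component of `x - x₀` in `W`. -/
noncomputable def compNorm (W : Submodule ℝ E) (x₀ x : E) : ℝ := ‖W.starProjection (x - x₀)‖

theorem compNorm_nonneg (W : Submodule ℝ E) (x₀ x : E) : 0 ≤ compNorm W x₀ x := norm_nonneg _

theorem continuous_compNorm (W : Submodule ℝ E) (x₀ : E) : Continuous (compNorm W x₀) :=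
  (W.starProjection.continuous.comp (continuous_id.sub continuous_const)).norm

theorem inner_starProjection_self (W : Submodule ℝ E) (v w : E) :
    ⟪W.starProjection v, W.starProjection w⟫ = ⟪W.starProjection v, w⟫ := by
  rw [← W.inner_starProjection_left_eq_right,
    Submodule.starProjection_eq_self_iff.2 (W.starProjection_apply_mem v)]

theorem hasFDerivAt_compNorm_sq (W : Submodule ℝ E) (x₀ x : E) :
    HasFDerivAt (fun y => compNorm W x₀ y ^ 2)
      ((2 : ℝ) • innerSL ℝ (W.starProjection (x - x₀))) x := by
  have h : HasFDerivAt (fun y => W.starProjection (y - x₀)) W.starProjection x :=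
    W.starProjection.hasFDerivAt.comp x ((hasFDerivAt_id x).sub_const x₀)
  refine h.norm_sq.congr_fderiv ?_
  ext v
  have : ⟪W.starProjection x - W.starProjection x₀, W.starProjection v⟫ =
      ⟪W.starProjection x - W.starProjection x₀, v⟫ := by
    rw [← map_sub, inner_starProjection_self]
  simp [this, ← inner_sub_left]

theorem hasFDerivAt_log_compNorm (W : Submodule ℝ E) (x₀ : E) {x : E} (hx : compNorm W x₀ x ≠ 0) :
    HasFDerivAt (fun y => Real.log (compNorm W x₀ y))
      ((compNorm W x₀ x ^ 2)⁻¹ • innerSL ℝ (W.starProjection (x - x₀))) x := by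
  have h := ((hasFDerivAt_compNorm_sq W x₀ x).log (pow_ne_zero 2 hx)).const_mul (1 / 2 : ℝ)
  have e : (fun y => 1 / 2 * Real.log (compNorm W x₀ y ^ 2)) =
      fun y => Real.log (compNorm W x₀ y) := by
    ext y
    rw [Real.log_pow]
    push_cast
    ring
  rw [e] at h
  refine h.congr_fderiv ?_
  rw [smul_smul, smul_smul]
  congr 1
  ring

theorem contDiff_compNorm_sq (W : Submodule ℝ E) (x₀ : E) {n : WithTop ℕ∞} :
    ContDiff ℝ n fun y => compNorm W x₀ y ^ 2 :=
  (W.starProjection.contDiff.comp (contDiff_id.sub contDiff_const)).norm_sq ℝ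

theorem contDiffAt_log_compNorm (W : Submodule ℝ E) (x₀ : E) {n : WithTop ℕ∞} {x : E}
    (hx : compNorm W x₀ x ≠ 0) : ContDiffAt ℝ n (fun y => Real.log (compNorm W x₀ y)) x := by
  have e : (fun y => Real.log (compNorm W x₀ y)) =
      fun y => 1 / 2 * Real.log (compNorm W x₀ y ^ 2) := by
    ext y
    rw [Real.log_pow]
    push_cast
    ring
  rw [e]
  exact contDiffAt_const.mul ((contDiff_compNorm_sq W x₀).contDiffAt.log (pow_ne_zero 2 hx))

theorem starProjection_orthogonal_starProjection (W : Submodule ℝ E) (v : E) :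
    W.starProjection (Wᗮ.starProjection v) = 0 := by
  rw [Submodule.starProjection_apply_eq_zero_iff]
  exact Submodule.starProjection_apply_mem _ _

theorem inner_starProjection_orthogonal (W : Submodule ℝ E) (v w : E) :
    ⟪W.starProjection v, Wᗮ.starProjection w⟫ = 0 := by
  rw [W.inner_starProjection_left_eq_right, starProjection_orthogonal_starProjection,
    inner_zero_right]

theorem inner_orthogonal_starProjection (W : Submodule ℝ E) (v w : E) :
    ⟪Wᗮ.starProjection v, W.starProjection w⟫ = 0 := by
  rw [real_inner_comm, inner_starProjection_orthogonal]

end Cylindrical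

/-! ### The operator `H` in cylindrical coordinates. -/

section Divergence

variable {d : ℕ}

theorem trace_starProjection (W : Submodule ℝ (Space d)) :
    ∑ j, W.starProjection (EuclideanSpace.single j 1) j = (Module.finrank ℝ W : ℝ) := by
  have h : LinearMap.IsProj W (W.starProjection : Space d →ₗ[ℝ] Space d) :=
    ⟨fun x => W.starProjection_apply_mem x,
      fun x hx => Submodule.starProjection_eq_self_iff.2 hx⟩
  rw [← h.trace, LinearMap.trace_eq_sum_inner _ (EuclideanSpace.basisFun (Fin d) ℝ)]
  refine Finset.sum_congr rfl fun j _ => ?_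
  simp [EuclideanSpace.inner_single_left]

/-- The divergence of `a(y) L (y - x₀)` for an orthogonal projection `L`. -/
theorem sum_pderiv_mul_starProjection (W : Submodule ℝ (Space d)) (x₀ : Space d)
    {a : Space d → ℝ} {a' : Space d →L[ℝ] ℝ} {x : Space d} (ha : HasFDerivAt a a' x) :
    ∑ j, pderiv j (fun y => a y * W.starProjection (y - x₀) j) x =
      a' (W.starProjection (x - x₀)) + a x * Module.finrank ℝ W := by
  have h : ∀ j, pderiv j (fun y => a y * W.starProjection (y - x₀) j) x =
      a' (EuclideanSpace.single j 1) * W.starProjection (x - x₀) j +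
        a x * W.starProjection (EuclideanSpace.single j 1) j := by
    intro j
    have h1 : HasFDerivAt (fun y => W.starProjection (y - x₀)) W.starProjection x :=
      W.starProjection.hasFDerivAt.comp x ((hasFDerivAt_id x).sub_const x₀)
    have h2 : HasFDerivAt (fun y => W.starProjection (y - x₀) j)
        ((EuclideanSpace.proj j : Space d →L[ℝ] ℝ).comp W.starProjection) x :=
      (EuclideanSpace.proj j : Space d →L[ℝ] ℝ).hasFDerivAt.comp x h1
    rw [pderiv, (ha.fun_mul h2).fderiv]
    simp [mul_comm]
    ring
  simp_rw [h]
  rw [Finset.sum_add_distrib, ← Finset.mul_sum, trace_starProjection]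
  congr 1
  have hv : W.starProjection (x - x₀) =
      ∑ j, W.starProjection (x - x₀) j • EuclideanSpace.single j (1 : ℝ) := by
    simpa using ((EuclideanSpace.basisFun (Fin d) ℝ).sum_repr (W.starProjection (x - x₀))).symm
  conv_rhs => rw [hv, map_sum]
  exact Finset.sum_congr rfl fun j _ => by rw [map_smul, smul_eq_mul, mul_comm]

variable {V : Submodule ℝ (Space d)} {x₀ : Space d}

theorem hasFDerivAt_cylindrical {f h : ℝ → ℝ} {f' h' : ℝ} {x : Space d}
    (hx : compNorm Vᗮ x₀ x ≠ 0) (hf : HasDerivAt f f' (compNorm V x₀ x ^ 2))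
    (hh : HasDerivAt h h' (Real.log (compNorm Vᗮ x₀ x))) :
    HasFDerivAt (fun y => f (compNorm V x₀ y ^ 2) * h (Real.log (compNorm Vᗮ x₀ y)))
      ((f (compNorm V x₀ x ^ 2) * h' * (compNorm Vᗮ x₀ x ^ 2)⁻¹) •
          innerSL ℝ (Vᗮ.starProjection (x - x₀)) +
        (h (Real.log (compNorm Vᗮ x₀ x)) * f' * 2) • innerSL ℝ (V.starProjection (x - x₀))) x := by
  have h1 := hf.comp_hasFDerivAt x (hasFDerivAt_compNorm_sq V x₀ x)
  have h2 := hh.comp_hasFDerivAt x (hasFDerivAt_log_compNorm Vᗮ x₀ hx)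
  refine (h1.fun_mul h2).congr_fderiv ?_
  simp only [smul_smul, Function.comp_apply]
  congr 2 <;> ring

/-- The action of `H` on a function of the two norms `‖P (x - x₀)‖` and `‖Q (x - x₀)‖`, where `P`
and `Q` are the orthogonal projections on `V` and `Vᗮ`, near a point where the weight depends only
on the second one. -/
theorem H_cylindrical {δ δ' : ℝ} {K : Set (Space d)} {φ : Space d → ℝ}
    {X X' X'' Y Y' Y'' G G' : ℝ → ℝ}
    (hX : ∀ s, HasDerivAt X (X' s) s) (hX' : ∀ s, HasDerivAt X' (X'' s) s)
    (hY : ∀ s, HasDerivAt Y (Y' s) s) (hY' : ∀ s, HasDerivAt Y' (Y'' s) s)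
    (hG : ∀ s, HasDerivAt G (G' s) s) {x : Space d} (hx : compNorm Vᗮ x₀ x ≠ 0)
    (hφ : φ =ᶠ[𝓝 x] fun y => X (compNorm V x₀ y ^ 2) * Y (Real.log (compNorm Vᗮ x₀ y)))
    (hw : ∀ᶠ y in 𝓝 x, weight δ δ' K y = G (Real.log (compNorm Vᗮ x₀ y))) :
    H δ δ' K φ x =
      -(G (Real.log (compNorm Vᗮ x₀ x)) * Y (Real.log (compNorm Vᗮ x₀ x)) *
          (4 * compNorm V x₀ x ^ 2 * X'' (compNorm V x₀ x ^ 2) +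
            2 * Module.finrank ℝ V * X' (compNorm V x₀ x ^ 2)) +
        X (compNorm V x₀ x ^ 2) * Real.exp (-2 * Real.log (compNorm Vᗮ x₀ x)) *
          (G' (Real.log (compNorm Vᗮ x₀ x)) * Y' (Real.log (compNorm Vᗮ x₀ x)) +
            G (Real.log (compNorm Vᗮ x₀ x)) * (Y'' (Real.log (compNorm Vᗮ x₀ x)) +
              ((Module.finrank ℝ Vᗮ : ℝ) - 2) * Y' (Real.log (compNorm Vᗮ x₀ x))))) := by
  have hne : ∀ᶠ y in 𝓝 x, compNorm Vᗮ x₀ y ≠ 0 :=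
    (continuous_compNorm Vᗮ x₀).continuousAt.eventually_ne hx
  have hexp : ∀ y, compNorm Vᗮ x₀ y ≠ 0 →
      Real.exp (-2 * Real.log (compNorm Vᗮ x₀ y)) = (compNorm Vᗮ x₀ y ^ 2)⁻¹ := by
    intro y hy
    have hpos : 0 < compNorm Vᗮ x₀ y := lt_of_le_of_ne (norm_nonneg _) hy.symm
    rw [neg_mul, Real.exp_neg, two_mul, Real.exp_add, Real.exp_log hpos, sq]
  set a₁ : Space d → ℝ := fun y => 2 * X' (compNorm V x₀ y ^ 2) *
    (G (Real.log (compNorm Vᗮ x₀ y)) * Y (Real.log (compNorm Vᗮ x₀ y)))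
  set a₂ : Space d → ℝ := fun y => X (compNorm V x₀ y ^ 2) *
    (G (Real.log (compNorm Vᗮ x₀ y)) * Y' (Real.log (compNorm Vᗮ x₀ y)) *
      Real.exp (-2 * Real.log (compNorm Vᗮ x₀ y)))
  -- Near `x` the flux `c ∇φ` is a sum of two fields, each a scalar times a projected position
  -- vector. In the divergence the mixed terms vanish by orthogonality.
  have hflux : ∀ j, (fun y => weight δ δ' K y * pderiv j φ y) =ᶠ[𝓝 x]
      fun y => a₁ y * V.starProjection (y - x₀) j + a₂ y * Vᗮ.starProjection (y - x₀) j := by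
    intro j
    filter_upwards [hne, hφ.eventuallyEq_nhds, hw] with y hy hφy hwy
    rw [hwy, pderiv, hφy.fderiv_eq,
      (hasFDerivAt_cylindrical hy (hX _) (hY _)).fderiv]
    have e : ∀ w : Space d, innerSL ℝ w (EuclideanSpace.single j 1) = w j := fun w => by
      rw [innerSL_apply_apply, EuclideanSpace.inner_single_right]
      simp
    simp only [add_apply, smul_apply, smul_eq_mul, e, a₁, a₂, hexp y hy]
    ring
  have d₁ : HasFDerivAt a₁ _ x := hasFDerivAt_cylindrical hx ((hX' _).const_mul 2)
    ((hG _).fun_mul (hY _))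
  have hE : ∀ s, HasDerivAt (fun s : ℝ => Real.exp (-2 * s)) (Real.exp (-2 * s) * (-2)) s := by
    intro s
    simpa using ((hasDerivAt_id s).const_mul (-2)).exp
  have d₂ : HasFDerivAt a₂ _ x := hasFDerivAt_cylindrical hx (hX _)
    (((hG _).fun_mul (hY' _)).fun_mul (hE _))
  have hsplit : ∀ j, pderiv j (fun y => weight δ δ' K y * pderiv j φ y) x =
      pderiv j (fun y => a₁ y * V.starProjection (y - x₀) j) x +
        pderiv j (fun y => a₂ y * Vᗮ.starProjection (y - x₀) j) x := by
    intro j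
    have hp : ∀ W : Submodule ℝ (Space d),
        DifferentiableAt ℝ (fun y => W.starProjection (y - x₀) j) x := by
      intro W
      fun_prop
    have e := fderiv_fun_add (d₁.differentiableAt.fun_mul (hp V))
      (d₂.differentiableAt.fun_mul (hp Vᗮ))
    rw [pderiv, (hflux j).fderiv_eq, e]
    rfl
  have hn : ∀ W : Submodule ℝ (Space d), ⟪W.starProjection (x - x₀), W.starProjection (x - x₀)⟫ =
      compNorm W x₀ x ^ 2 := fun W => by rw [real_inner_self_eq_norm_sq, compNorm]
  rw [H]
  simp_rw [hsplit]
  rw [Finset.sum_add_distrib, sum_pderiv_mul_starProjection V x₀ d₁,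
    sum_pderiv_mul_starProjection Vᗮ x₀ d₂]
  simp only [add_apply, smul_apply, smul_eq_mul, innerSL_apply_apply, hn,
    inner_starProjection_orthogonal, inner_orthogonal_starProjection, a₁, a₂, hexp x hx]
  field_simp
  ring

end Divergence

end Rellich

namespace Rellich

open Metric Topology RealInnerProductSpace

/-! ### Cylindrical shells and their logarithmic integrals. -/

section Layer

variable {E : Type*} [NormedAddCommGroup E] [InnerProductSpace ℝ E] [FiniteDimensional ℝ E]

/-- The points whose component in `V` has norm at most `ρ` and whose component in `Vᗮ` has norm in
`[s₁, s₂]`, relative to the origin `x₀`. -/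
def layer (V : Submodule ℝ E) (x₀ : E) (ρ s₁ s₂ : ℝ) : Set E :=
  {x | compNorm V x₀ x ≤ ρ ∧ compNorm Vᗮ x₀ x ∈ Icc s₁ s₂}

theorem isClosed_layer (V : Submodule ℝ E) (x₀ : E) (ρ s₁ s₂ : ℝ) :
    IsClosed (layer V x₀ ρ s₁ s₂) :=
  (isClosed_Iic.preimage (continuous_compNorm V x₀)).inter
    (isClosed_Icc.preimage (continuous_compNorm Vᗮ x₀))

theorem isCompact_layer (V : Submodule ℝ E) (x₀ : E) (ρ s₁ s₂ : ℝ) :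
    IsCompact (layer V x₀ ρ s₁ s₂) := by
  refine isCompact_of_isClosed_isBounded (isClosed_layer V x₀ ρ s₁ s₂)
    ((isBounded_closedBall (x := x₀) (r := ρ + s₂)).subset fun x hx => ?_)
  rw [mem_closedBall, dist_eq_norm]
  have h := V.starProjection_add_starProjection_orthogonal (x - x₀)
  rw [← h]
  exact (norm_add_le _ _).trans (add_le_add hx.1 hx.2.2)

theorem integrableOn_layer [MeasurableSpace E] [BorelSpace E] (V : Submodule ℝ E) (x₀ : E)
    (ρ : ℝ) {s₁ : ℝ} (hs₁ : 0 < s₁) (s₂ r : ℝ) :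
    IntegrableOn (fun x => compNorm Vᗮ x₀ x ^ r) (layer V x₀ ρ s₁ s₂) := by
  refine ContinuousOn.integrableOn_of_subset_isCompact (K := layer V x₀ ρ s₁ s₂) ?_
    (isCompact_layer V x₀ ρ s₁ s₂) (isClosed_layer V x₀ ρ s₁ s₂).measurableSet Subset.rfl
    (isCompact_layer V x₀ ρ s₁ s₂).measure_ne_top
  exact (continuous_compNorm Vᗮ x₀).continuousOn.rpow_const
    fun x hx => Or.inl (hs₁.trans_le hx.2.1).ne'

/-- Integrals of products of functions of the two components. -/
theorem integral_comp_norm_mul [MeasurableSpace E] [BorelSpace E] (V : Submodule ℝ E) (x₀ : E)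
    (f g : ℝ → ℝ) :
    ∫ x, f (compNorm V x₀ x) * g (compNorm Vᗮ x₀ x) = (∫ y : V, f ‖y‖) * ∫ z : Vᗮ, g ‖z‖ := by
  have h1 : ∀ x, f (compNorm V x₀ x) * g (compNorm Vᗮ x₀ x) =
      (fun x => f (compNorm V 0 x) * g (compNorm Vᗮ 0 x)) (x - x₀) := by
    intro x
    simp [compNorm]
  simp_rw [h1]
  rw [integral_sub_right_eq_self (fun x => f (compNorm V 0 x) * g (compNorm Vᗮ 0 x)) x₀]
  have mp : MeasurePreserving (fun x => WithLp.ofLp (V.orthogonalDecomposition x)) :=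
    (WithLp.volume_preserving_ofLp V Vᗮ).comp V.orthogonalDecomposition.measurePreserving
  have me : MeasurableEmbedding (fun x => WithLp.ofLp (V.orthogonalDecomposition x)) := by
    have := (V.orthogonalDecomposition.toHomeomorph.toMeasurableEquiv.trans
      (MeasurableEquiv.toLp 2 (V × Vᗮ)).symm).measurableEmbedding
    exact this
  have h2 := mp.integral_comp me (fun z : V × Vᗮ => f ‖z.1‖ * g ‖z.2‖)
  rw [← integral_prod_mul (fun y : V => f ‖y‖) (fun z : Vᗮ => g ‖z‖)]
  refine Eq.trans ?_ h2
  refine integral_congr_ae (Eventually.of_forall fun x => ?_)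
  simp only [compNorm, sub_zero, Submodule.starProjection_apply]
  rw [← V.fst_orthogonalDecomposition_apply, ← V.snd_orthogonalDecomposition_apply]
  rfl

/-- The exponent cancels the polar Jacobian `s^(a-1)` down to `s⁻¹`, hence the logarithm. Since `c`
does not depend on the shell, the ratio for two shells is explicit. -/
theorem integral_layer [MeasurableSpace E] [BorelSpace E] (V : Submodule ℝ E)
    (hV : 0 < Module.finrank ℝ Vᗮ) :
    ∃ c : ℝ, 0 < c ∧ ∀ (x₀ : E) (ρ s₁ s₂ : ℝ), 0 ≤ ρ → 0 < s₁ → s₁ ≤ s₂ →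
      ∫ x in layer V x₀ ρ s₁ s₂, compNorm Vᗮ x₀ x ^ (-(Module.finrank ℝ Vᗮ : ℝ)) =
        c * ρ ^ Module.finrank ℝ V * Real.log (s₂ / s₁) := by
  set a := Module.finrank ℝ Vᗮ with ha
  have hnt : Nontrivial Vᗮ := Module.finrank_pos_iff.1 hV
  set cV : ℝ := (volume : Measure V).real (closedBall 0 1)
  set cW : ℝ := (volume : Measure Vᗮ).real (ball 0 1)
  have hcV : 0 < cV := ENNReal.toReal_pos (measure_closedBall_pos _ _ one_pos).ne'
    (isCompact_closedBall 0 1).measure_ne_top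
  have hcW : 0 < cW := ENNReal.toReal_pos (measure_ball_pos _ _ one_pos).ne'
    measure_ball_lt_top.ne
  refine ⟨cV * (a * cW), by positivity, fun x₀ ρ s₁ s₂ hρ hs₁ hs => ?_⟩
  have hind : ∀ x, (layer V x₀ ρ s₁ s₂).indicator
      (fun x => compNorm Vᗮ x₀ x ^ (-(a : ℝ))) x =
      (Iic ρ).indicator (fun _ => (1 : ℝ)) (compNorm V x₀ x) *
        (Icc s₁ s₂).indicator (fun s => s ^ (-(a : ℝ))) (compNorm Vᗮ x₀ x) := by
    intro x
    by_cases h1 : compNorm V x₀ x ≤ ρ <;> by_cases h2 : compNorm Vᗮ x₀ x ∈ Icc s₁ s₂ <;>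
      simp only [indicator, layer, mem_ofPred_eq, mem_Iic, h1, h2] <;> simp
  rw [← integral_indicator (isClosed_layer V x₀ ρ s₁ s₂).measurableSet]
  simp_rw [hind]
  rw [integral_comp_norm_mul V x₀ ((Iic ρ).indicator fun _ => (1 : ℝ))
    ((Icc s₁ s₂).indicator fun s => s ^ (-(a : ℝ)))]
  have e1 : ∫ y : V, (Iic ρ).indicator (fun _ => (1 : ℝ)) ‖y‖ = cV * ρ ^ Module.finrank ℝ V := by
    have h : ∀ y : V, (Iic ρ).indicator (fun _ => (1 : ℝ)) ‖y‖ =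
        (closedBall (0 : V) ρ).indicator (fun _ => 1) y := by
      intro y
      simp [indicator]
    simp_rw [h]
    rw [integral_indicator measurableSet_closedBall, setIntegral_const, smul_eq_mul, mul_one,
      measureReal_def, Measure.addHaar_closedBall' _ _ hρ, ENNReal.toReal_mul,
      ENNReal.toReal_ofReal (by positivity), mul_comm]
    rfl
  have e2 : ∫ z : Vᗮ, (Icc s₁ s₂).indicator (fun s => s ^ (-(a : ℝ))) ‖z‖ =
      a * cW * Real.log (s₂ / s₁) := by
    rw [integral_fun_norm_addHaar volume ((Icc s₁ s₂).indicator fun s => s ^ (-(a : ℝ))),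
      nsmul_eq_mul, smul_eq_mul, mul_assoc]
    congr 2
    have h : ∀ y ∈ Ioi (0 : ℝ), y ^ (Module.finrank ℝ Vᗮ - 1) •
        (Icc s₁ s₂).indicator (fun s => s ^ (-(a : ℝ))) y =
        (Icc s₁ s₂).indicator (fun s => s⁻¹) y := by
      intro y hy
      have hy' : (0 : ℝ) < y := hy
      by_cases hm : y ∈ Icc s₁ s₂
      · rw [indicator_of_mem hm, indicator_of_mem hm, smul_eq_mul, ← Real.rpow_natCast,
          ← Real.rpow_add hy', ← Real.rpow_neg_one]
        congr 1
        rw [← ha, Nat.cast_sub hV, Nat.cast_one]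
        ring
      · rw [indicator_of_notMem hm, indicator_of_notMem hm, smul_zero]
    have hsub : Icc s₁ s₂ ⊆ Ioi 0 := fun y hy => hs₁.trans_le hy.1
    rw [setIntegral_congr_fun measurableSet_Ioi h, setIntegral_indicator measurableSet_Icc,
      inter_eq_right.2 hsub, integral_Icc_eq_integral_Ioc,
      ← intervalIntegral.integral_of_le hs, integral_inv_of_pos hs₁ (hs₁.trans_le hs)]
  rw [e1, e2]
  ring

end Layer

end Rellich

/-! ### Cutoffs and test functions above a flat piece of `K`. -/

namespace Rellich

open Metric Topology RealInnerProductSpace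

/-- A `C²` cutoff function, equal to `1` on `[-1, 1]` and to `0` off `(-2, 2)`, with its first two
derivatives and a bound `M` for them. -/
structure IsCutoff (b b₁ b₂ : ℝ → ℝ) (M : ℝ) : Prop where
  contDiff : ContDiff ℝ 2 b
  hasDerivAt : ∀ s, HasDerivAt b (b₁ s) s
  hasDerivAt₁ : ∀ s, HasDerivAt b₁ (b₂ s) s
  abs_le_one : ∀ s, |b s| ≤ 1
  eq_one : ∀ s, |s| ≤ 1 → b s = 1
  eq_zero : ∀ s, 2 ≤ |s| → b s = 0
  abs_le₁ : ∀ s, |b₁ s| ≤ M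
  abs_le₂ : ∀ s, |b₂ s| ≤ M

theorem exists_isCutoff : ∃ b b₁ b₂ M, IsCutoff b b₁ b₂ M := by
  let b : ContDiffBump (0 : ℝ) := ⟨1, 2, one_pos, one_lt_two⟩
  have h2 : ContDiff ℝ 2 b := b.contDiff
  have h1 : ContDiff ℝ 1 (deriv b) := by
    have : ContDiff ℝ (1 + 1) b := by simpa [one_add_one_eq_two] using h2
    exact (contDiff_succ_iff_deriv.1 this).2.2
  have c1 : HasCompactSupport (deriv b) := b.hasCompactSupport.deriv
  obtain ⟨M₁, hM₁⟩ := c1.exists_bound_of_continuous h1.continuous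
  obtain ⟨M₂, hM₂⟩ := c1.deriv.exists_bound_of_continuous (h1.continuous_deriv le_rfl)
  refine ⟨b, deriv b, deriv (deriv b), max M₁ M₂, h2,
    fun s => (h2.differentiable two_ne_zero s).hasDerivAt,
    fun s => (h1.differentiable one_ne_zero s).hasDerivAt,
    fun s => by rw [abs_of_nonneg b.nonneg]; exact b.le_one,
    fun s hs => b.one_of_mem_closedBall (by simpa using hs),
    fun s hs => b.zero_of_le_dist (by simpa using hs),
    fun s => (hM₁ s).trans (le_max_left _ _), fun s => (hM₂ s).trans (le_max_right _ _)⟩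

/-- The bracket is the logarithmic derivative of the coefficient in `t = log s`; it tends to `δ` as
`t → -∞` and to `δ'` as `t → ∞`. -/
theorem hasDerivAt_coeff_exp (δ δ' t : ℝ) :
    HasDerivAt (fun t => coeff δ δ' (Real.exp t)) (coeff δ δ' (Real.exp t) *
      (δ + (δ' - δ) * Real.exp t / (1 + Real.exp t))) t := by
  have he := Real.exp_pos t
  have h1 : HasDerivAt (fun t => Real.exp t ^ δ) (δ * Real.exp t ^ δ) t := by
    have e : (fun t => Real.exp t ^ δ) = fun t => Real.exp (δ * t) := by
      ext s
      rw [← Real.exp_mul, mul_comm]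
    rw [e, ← Real.exp_mul, mul_comm t δ, mul_comm δ]
    simpa using ((hasDerivAt_id t).const_mul δ).exp
  have h2 := ((Real.hasDerivAt_exp t).const_add 1).rpow_const (p := δ' - δ)
    (Or.inl (by positivity))
  refine (h1.fun_mul h2).congr_deriv ?_
  rw [coeff, Real.rpow_sub_one (by positivity)]
  field_simp

section TestFunction

variable {d : ℕ} {V : Submodule ℝ (Space d)} {x₀ : Space d} {K : Set (Space d)}
  {b b₁ b₂ : ℝ → ℝ} {M α R t₀ L : ℝ}

/-- The test functions for the upper bound: `s^(-α)`, where `s` is the distance to the flat piece,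
cut off on a logarithmic scale in `s` and on the scale `R` along `V`. -/
noncomputable def testFn (V : Submodule ℝ (Space d)) (x₀ : Space d) (b : ℝ → ℝ) (α R t₀ L : ℝ)
    (x : Space d) : ℝ :=
  b (compNorm V x₀ x ^ 2 / R ^ 2) * (Real.exp (-α * Real.log (compNorm Vᗮ x₀ x)) *
    b ((Real.log (compNorm Vᗮ x₀ x) - t₀) / L))

/-- The orthogonal projection of `x` to `x₀ + V` falls inside the flat ball, hence in `K`, and no
point of `K ⊆ x₀ + V` is closer. -/
theorem infDist_eq_compNorm (hball : ∀ z ∈ V, ‖z‖ ≤ 2 * R → x₀ + z ∈ K)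
    (hsub : ∀ y ∈ K, y - x₀ ∈ V) {x : Space d} (hx : compNorm V x₀ x ≤ 2 * R) :
    infDist x K = compNorm Vᗮ x₀ x := by
  have hdec := V.starProjection_add_starProjection_orthogonal (x - x₀)
  have hmem : x₀ + V.starProjection (x - x₀) ∈ K :=
    hball _ (V.starProjection_apply_mem _) hx
  have e1 : x - (x₀ + V.starProjection (x - x₀)) = Vᗮ.starProjection (x - x₀) := by
    rw [sub_add_eq_sub_sub]
    nth_rewrite 1 [← hdec]
    abel
  apply le_antisymm
  · have := infDist_le_dist_of_mem (x := x) hmem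
    rwa [dist_eq_norm, e1] at this
  · refine (le_infDist ⟨_, hmem⟩).2 fun y hy => ?_
    rw [dist_eq_norm, compNorm]
    have : Vᗮ.starProjection (x - x₀) = Vᗮ.starProjection (x - y) := by
      have h0 : Vᗮ.starProjection (y - x₀) = 0 := by
        rw [Submodule.starProjection_apply_eq_zero_iff, Submodule.orthogonal_orthogonal]
        exact hsub y hy
      rw [show x - x₀ = (x - y) + (y - x₀) by abel, map_add, h0, add_zero]
    rw [this]
    exact Submodule.norm_starProjection_apply_le _ _

variable (hb : IsCutoff b b₁ b₂ M) (hR : 0 < R) (hL : 0 < L) (ht : 2 * L ≤ |t₀|)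
include hb hR hL ht

theorem support_testFn_subset : Function.support (testFn V x₀ b α R t₀ L) ⊆
    layer V x₀ (√2 * R) (Real.exp (t₀ - 2 * L)) (Real.exp (t₀ + 2 * L)) := by
  intro x hx
  rw [Function.mem_support, testFn, mul_ne_zero_iff, mul_ne_zero_iff] at hx
  obtain ⟨h1, -, h2⟩ := hx
  have h1' : |compNorm V x₀ x ^ 2 / R ^ 2| < 2 := by
    by_contra! h
    exact h1 (hb.eq_zero _ h)
  have h2' : |(Real.log (compNorm Vᗮ x₀ x) - t₀) / L| < 2 := by
    by_contra! h
    exact h2 (hb.eq_zero _ h)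
  rw [abs_div, abs_of_pos hL, div_lt_iff₀ hL] at h2'
  -- By convention `log 0 = 0`. The condition `2L ≤ |t₀|` puts the value `0` outside the window, so
  -- the cutoff vanishes there.
  have hne : compNorm Vᗮ x₀ x ≠ 0 := by
    intro h
    rw [h, Real.log_zero, zero_sub, abs_neg] at h2'
    linarith
  have hpos : 0 < compNorm Vᗮ x₀ x := lt_of_le_of_ne (compNorm_nonneg _ _ _) hne.symm
  rw [abs_lt] at h2'
  refine ⟨?_, ?_, ?_⟩
  · rw [abs_of_nonneg (by positivity), div_lt_iff₀ (by positivity)] at h1'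
    refine le_of_sq_le_sq ?_ (by positivity)
    rw [mul_pow, Real.sq_sqrt zero_le_two]
    exact h1'.le
  · rw [← Real.le_log_iff_exp_le hpos]
    linarith
  · rw [← Real.log_le_iff_le_exp hpos]
    linarith

theorem tsupport_testFn_subset : tsupport (testFn V x₀ b α R t₀ L) ⊆
    layer V x₀ (√2 * R) (Real.exp (t₀ - 2 * L)) (Real.exp (t₀ + 2 * L)) :=
  closure_minimal (support_testFn_subset hb hR hL ht) (isClosed_layer _ _ _ _ _)

theorem contDiff_testFn : ContDiff ℝ 2 (testFn V x₀ b α R t₀ L) := by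
  rw [contDiff_iff_contDiffAt]
  intro x
  by_cases hx : compNorm Vᗮ x₀ x = 0
  · have hnot : x ∉ tsupport (testFn V x₀ b α R t₀ L) := fun h => by
      have := (tsupport_testFn_subset hb hR hL ht h).2.1
      rw [hx] at this
      exact absurd this (not_le.2 (Real.exp_pos _))
    exact contDiffAt_const.congr_of_eventuallyEq (notMem_tsupport_iff_eventuallyEq.1 hnot)
  · have hτ := contDiffAt_log_compNorm Vᗮ x₀ (n := 2) hx
    refine ContDiffAt.mul ?_ (ContDiffAt.mul ?_ ?_)
    · exact hb.contDiff.contDiffAt.comp x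
        ((contDiff_compNorm_sq V x₀).contDiffAt.div_const (R ^ 2))
    · exact (contDiffAt_const.mul hτ).exp
    · exact hb.contDiff.contDiffAt.comp x ((hτ.sub contDiffAt_const).div_const L)

theorem isTest_testFn (hsub : ∀ y ∈ K, y - x₀ ∈ V) :
    IsTest (domain K) (testFn V x₀ b α R t₀ L) := by
  have hts := tsupport_testFn_subset (V := V) (x₀ := x₀) (α := α) hb hR hL ht
  refine ⟨contDiff_testFn hb hR hL ht,
    (isCompact_layer _ _ _ _ _).of_isClosed_subset (isClosed_tsupport _) hts, fun x hx hxK => ?_⟩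
  have h1 := (hts hx).2.1
  have h0 : compNorm Vᗮ x₀ x = 0 := by
    rw [compNorm, norm_eq_zero, Submodule.starProjection_apply_eq_zero_iff,
      Submodule.orthogonal_orthogonal]
    exact hsub x hxK
  rw [h0] at h1
  exact absurd h1 (not_le.2 (Real.exp_pos _))

omit ht in
theorem testFn_eq_of_mem_layer {x : Space d}
    (hx : x ∈ layer V x₀ R (Real.exp (t₀ - L)) (Real.exp (t₀ + L))) :
    testFn V x₀ b α R t₀ L x = Real.exp (-α * Real.log (compNorm Vᗮ x₀ x)) := by
  have hpos : 0 < compNorm Vᗮ x₀ x := (Real.exp_pos _).trans_le hx.2.1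
  rw [testFn, hb.eq_one, hb.eq_one, one_mul, mul_one]
  · rw [abs_div, abs_of_pos hL, div_le_one hL, abs_le]
    have h1 := (Real.le_log_iff_exp_le hpos).2 hx.2.1
    have h2 := (Real.log_le_iff_le_exp hpos).2 hx.2.2
    constructor <;> linarith
  · rw [abs_of_nonneg (by positivity), div_le_one (by positivity)]
    exact pow_le_pow_left₀ (compNorm_nonneg _ _ _) hx.1 2

end TestFunction

end Rellich

/-! ### Error of the test function as an approximate extremal. -/

namespace Rellich

open Metric Topology RealInnerProductSpace

/-- The constant in the bound for the error terms of the test functions. -/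
noncomputable def errConst (M α a k σ : ℝ) : ℝ :=
  M * (8 + 2 * k) + (M + α) + M + |a - 2 + σ - 2 * α| * M

/-- Three sources of error are each `O(ε)`: derivatives along `V`, of size `w / R²` with `w = s²`;
the deviation of the logarithmic slope `κ` of the weight from `σ`; and derivatives of the
logarithmic cutoff, each of which gains `1 / L`. -/
theorem abs_error_le {M α a k σ ε L R u w κ X X₁ X₂ ξ ξ₁ ξ₂ : ℝ} (hM : 0 ≤ M) (hα : 0 ≤ α)
    (hk : 0 ≤ k) (hR : 0 < R) (hL : 1 ≤ L) (hLε : 1 / L ≤ ε) (hu : 0 ≤ u) (hu2 : u ≤ 2 * R ^ 2)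
    (hw : 0 ≤ w) (hwR : w ≤ ε * R ^ 2) (hκ : |κ - σ| ≤ ε) (hX : |X| ≤ 1) (hX₁ : |X₁| ≤ M)
    (hX₂ : |X₂| ≤ M) (hξ : |ξ| ≤ 1) (hξ₁ : |ξ₁| ≤ M) (hξ₂ : |ξ₂| ≤ M) :
    |w * ξ * (4 * u * (X₂ / R ^ 2 / R ^ 2) + 2 * k * (X₁ / R ^ 2)) +
      X * ((κ - σ) * (ξ₁ / L - α * ξ) + ξ₂ / L / L + (a - 2 + σ - 2 * α) * (ξ₁ / L))| ≤
      errConst M α a k σ * ε := by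
  have hL0 : 0 < L := by linarith
  have hε : 0 ≤ ε := le_trans (by positivity) hLε
  have hiL : 1 / L ≤ 1 := by rw [div_le_one hL0]; exact hL
  have b1 : |w * ξ * (4 * u * (X₂ / R ^ 2 / R ^ 2) + 2 * k * (X₁ / R ^ 2))| ≤
      M * (8 + 2 * k) * ε := by
    have hq : |4 * u * (X₂ / R ^ 2 / R ^ 2) + 2 * k * (X₁ / R ^ 2)| ≤ M * (8 + 2 * k) / R ^ 2 := by
      have e1 : |4 * u * (X₂ / R ^ 2 / R ^ 2)| ≤ M * 8 / R ^ 2 := by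
        rw [abs_mul, abs_div, abs_div, abs_of_nonneg (by positivity : 0 ≤ 4 * u),
          abs_of_pos (by positivity : 0 < R ^ 2)]
        calc 4 * u * (|X₂| / R ^ 2 / R ^ 2) ≤ 4 * (2 * R ^ 2) * (M / R ^ 2 / R ^ 2) := by gcongr
          _ = M * 8 / R ^ 2 := by field_simp; ring
      have e2 : |2 * k * (X₁ / R ^ 2)| ≤ M * (2 * k) / R ^ 2 := by
        rw [abs_mul, abs_div, abs_of_nonneg (by positivity : 0 ≤ 2 * k),
          abs_of_pos (by positivity : 0 < R ^ 2)]
        calc 2 * k * (|X₁| / R ^ 2) ≤ 2 * k * (M / R ^ 2) := by gcongr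
          _ = M * (2 * k) / R ^ 2 := by ring
      refine (abs_add_le _ _).trans ((add_le_add e1 e2).trans (le_of_eq ?_))
      ring
    rw [abs_mul, abs_mul, abs_of_nonneg hw]
    calc w * |ξ| * |4 * u * (X₂ / R ^ 2 / R ^ 2) + 2 * k * (X₁ / R ^ 2)|
        ≤ (ε * R ^ 2) * 1 * (M * (8 + 2 * k) / R ^ 2) := by gcongr
      _ = M * (8 + 2 * k) * ε := by field_simp
  have hξ₁L : |ξ₁ / L| ≤ M * (1 / L) := by
    rw [abs_div, abs_of_pos hL0, mul_one_div]
    gcongr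
  have b2 : |(κ - σ) * (ξ₁ / L - α * ξ)| ≤ (M + α) * ε := by
    have : |ξ₁ / L - α * ξ| ≤ M + α := by
      refine (abs_sub _ _).trans (add_le_add (hξ₁L.trans ?_) ?_)
      · exact mul_le_of_le_one_right hM hiL
      · rw [abs_mul, abs_of_nonneg hα]
        exact mul_le_of_le_one_right hα hξ
    rw [abs_mul, mul_comm]
    gcongr
  have b3 : |ξ₂ / L / L| ≤ M * ε := by
    rw [abs_div, abs_div, abs_of_pos hL0]
    calc |ξ₂| / L / L = |ξ₂| * (1 / L) * (1 / L) := by ring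
      _ ≤ M * ε * 1 := by gcongr
      _ = M * ε := mul_one _
  have b4 : |(a - 2 + σ - 2 * α) * (ξ₁ / L)| ≤ |a - 2 + σ - 2 * α| * M * ε := by
    rw [abs_mul, mul_assoc]
    gcongr
    exact hξ₁L.trans (by gcongr)
  have b5 : |X * ((κ - σ) * (ξ₁ / L - α * ξ) + ξ₂ / L / L + (a - 2 + σ - 2 * α) * (ξ₁ / L))| ≤
      (M + α) * ε + M * ε + |a - 2 + σ - 2 * α| * M * ε := by
    rw [abs_mul]
    refine (mul_le_of_le_one_left (abs_nonneg _) hX).trans ?_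
    refine (abs_add_le _ _).trans (add_le_add ?_ b4)
    exact (abs_add_le _ _).trans (add_le_add b2 b3)
  refine (abs_add_le _ _).trans ((add_le_add b1 b5).trans (le_of_eq ?_))
  rw [errConst]
  ring

section TestFunction

variable {d : ℕ} {V : Submodule ℝ (Space d)} {x₀ : Space d} {K : Set (Space d)}
  {b b₁ b₂ : ℝ → ℝ} {M α R t₀ L δ δ' σ ε : ℝ}

/-- For weight `s^σ` and no cutoffs, `s^(-α)` satisfies `H s^(-α) = α(a - 2 + σ - α) s^(σ-2-α)`
exactly; everything else is the error estimated by `abs_error_le`. -/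
theorem abs_H_testFn_sub_le (hb : IsCutoff b b₁ b₂ M) (hR : 0 < R) (hL : 1 ≤ L)
    (ht : 2 * L ≤ |t₀|) (hα : 0 ≤ α) (hball : ∀ z ∈ V, ‖z‖ ≤ 2 * R → x₀ + z ∈ K)
    (hsub : ∀ y ∈ K, y - x₀ ∈ V) (hLε : 1 / L ≤ ε)
    (hκ : ∀ t ∈ Icc (t₀ - 2 * L) (t₀ + 2 * L),
      |δ + (δ' - δ) * Real.exp t / (1 + Real.exp t) - σ| ≤ ε)
    (hw : ∀ t ∈ Icc (t₀ - 2 * L) (t₀ + 2 * L), Real.exp (2 * t) ≤ ε * R ^ 2) {x : Space d}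
    (hx : x ∈ tsupport (testFn V x₀ b α R t₀ L)) :
    |H δ δ' K (testFn V x₀ b α R t₀ L) x -
      α * ((Module.finrank ℝ Vᗮ : ℝ) - 2 + σ - α) *
        (weight δ δ' K x / bdryDist K x ^ 2 * testFn V x₀ b α R t₀ L x)| ≤
      errConst M α (Module.finrank ℝ Vᗮ) (Module.finrank ℝ V) σ * ε *
        (coeff δ δ' (compNorm Vᗮ x₀ x) * compNorm Vᗮ x₀ x ^ (-(2 + α))) := by
  have hL0 : 0 < L := by linarith
  have hlay := tsupport_testFn_subset hb hR hL0 ht hx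
  have hs : 0 < compNorm Vᗮ x₀ x := (Real.exp_pos _).trans_le hlay.2.1
  set s := compNorm Vᗮ x₀ x with hs_def
  set u := compNorm V x₀ x ^ 2 with hu_def
  set τ := Real.log s with hτ_def
  have hτ : τ ∈ Icc (t₀ - 2 * L) (t₀ + 2 * L) :=
    ⟨(Real.le_log_iff_exp_le hs).2 hlay.2.1, (Real.log_le_iff_le_exp hs).2 hlay.2.2⟩
  have hu2 : u ≤ 2 * R ^ 2 := by
    have := pow_le_pow_left₀ (compNorm_nonneg _ _ _) hlay.1 2
    rwa [mul_pow, Real.sq_sqrt zero_le_two] at this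
  -- The support reaches only `√2 R`, strictly inside `2R`, so the formula for the distance holds on
  -- a neighbourhood, as differentiation requires.
  have hlt : compNorm V x₀ x < 2 * R := by
    refine lt_of_pow_lt_pow_left₀ 2 (by positivity) ?_
    nlinarith [sq_nonneg R, pow_pos hR 2]
  have hnear : ∀ᶠ y in 𝓝 x, infDist y K = compNorm Vᗮ x₀ y := by
    filter_upwards [(continuous_compNorm V x₀).continuousAt.eventually_lt_const hlt] with y hy
    exact infDist_eq_compNorm hball hsub hy.le
  have hne : ∀ᶠ y in 𝓝 x, 0 < compNorm Vᗮ x₀ y :=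
    (continuous_compNorm Vᗮ x₀).continuousAt.eventually_const_lt hs
  set X : ℝ → ℝ := fun s => b (s / R ^ 2)
  set X' : ℝ → ℝ := fun s => b₁ (s / R ^ 2) / R ^ 2
  set X'' : ℝ → ℝ := fun s => b₂ (s / R ^ 2) / R ^ 2 / R ^ 2
  set Y : ℝ → ℝ := fun t => Real.exp (-α * t) * b ((t - t₀) / L)
  set Y' : ℝ → ℝ := fun t => Real.exp (-α * t) * (b₁ ((t - t₀) / L) / L - α * b ((t - t₀) / L))
  set Y'' : ℝ → ℝ := fun t => Real.exp (-α * t) * (b₂ ((t - t₀) / L) / L / L -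
    2 * α * (b₁ ((t - t₀) / L) / L) + α ^ 2 * b ((t - t₀) / L))
  set G : ℝ → ℝ := fun t => coeff δ δ' (Real.exp t)
  have hdR : ∀ s : ℝ, HasDerivAt (fun s : ℝ => s / R ^ 2) (1 / R ^ 2) s := fun s =>
    (hasDerivAt_id s).div_const _
  have hdL : ∀ s : ℝ, HasDerivAt (fun s : ℝ => (s - t₀) / L) (1 / L) s := fun s =>
    ((hasDerivAt_id s).sub_const t₀).div_const _
  have hdE : ∀ s : ℝ, HasDerivAt (fun s : ℝ => Real.exp (-α * s)) (Real.exp (-α * s) * -α) s := by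
    intro s
    simpa using ((hasDerivAt_id s).const_mul (-α)).exp
  have hX : ∀ s, HasDerivAt X (X' s) s := fun s =>
    ((hb.hasDerivAt _).comp s (hdR s)).congr_deriv (by simp only [X']; ring)
  have hX' : ∀ s, HasDerivAt X' (X'' s) s := fun s =>
    (((hb.hasDerivAt₁ _).comp s (hdR s)).div_const (R ^ 2)).congr_deriv
      (by simp only [X'']; ring)
  have hbL : ∀ s, HasDerivAt (fun s => b ((s - t₀) / L)) (b₁ ((s - t₀) / L) / L) s := fun s =>
    ((hb.hasDerivAt _).comp s (hdL s)).congr_deriv (by ring)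
  have hbL' : ∀ s, HasDerivAt (fun s => b₁ ((s - t₀) / L)) (b₂ ((s - t₀) / L) / L) s := fun s =>
    ((hb.hasDerivAt₁ _).comp s (hdL s)).congr_deriv (by ring)
  have hY : ∀ s, HasDerivAt Y (Y' s) s := fun s =>
    ((hdE s).fun_mul (hbL s)).congr_deriv (by simp only [Y']; ring)
  have hY' : ∀ s, HasDerivAt Y' (Y'' s) s := fun s =>
    ((hdE s).fun_mul (((hbL' s).div_const L).fun_sub ((hbL s).const_mul α))).congr_deriv
      (by simp only [Y'']; ring)
  have hformula := H_cylindrical (V := V) (x₀ := x₀) (δ := δ) (δ' := δ') (K := K)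
    (φ := testFn V x₀ b α R t₀ L) hX hX' hY hY'
    (hasDerivAt_coeff_exp δ δ') hs.ne' EventuallyEq.rfl (by
      filter_upwards [hnear, hne] with y hy hy'
      rw [weight, bdryDist_eq, hy, Real.exp_log hy'])
  rw [hformula]
  simp only [← hs_def, ← hu_def, ← hτ_def]
  have hbd : bdryDist K x = s := by rw [bdryDist_eq, hnear.self_of_nhds]
  have hwt : weight δ δ' K x = coeff δ δ' s := by rw [weight, hbd]
  have htf : testFn V x₀ b α R t₀ L x = X u * Y τ := rfl
  have hexpτ : Real.exp τ = s := Real.exp_log hs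
  have hTs : s ^ (-(2 + α)) = Real.exp (-2 * τ) * Real.exp (-α * τ) := by
    rw [Real.rpow_def_of_pos hs, ← Real.exp_add]
    congr 1
    ring
  have hs2 : Real.exp (-2 * τ) * Real.exp (2 * τ) = 1 := by
    rw [← Real.exp_add]; simp
  have hs2' : (s ^ 2)⁻¹ = Real.exp (-2 * τ) := by
    rw [neg_mul, Real.exp_neg, two_mul, Real.exp_add, hexpτ, sq]
  have hM : 0 ≤ M := (abs_nonneg _).trans (hb.abs_le₁ 0)
  have hbound := abs_error_le (M := M) (α := α) (a := Module.finrank ℝ Vᗮ)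
    (k := Module.finrank ℝ V) (σ := σ) (ε := ε) (L := L) (R := R) (u := u)
    (w := Real.exp (2 * τ)) (κ := δ + (δ' - δ) * Real.exp τ / (1 + Real.exp τ))
    (X := b (u / R ^ 2)) (X₁ := b₁ (u / R ^ 2)) (X₂ := b₂ (u / R ^ 2)) (ξ := b ((τ - t₀) / L))
    (ξ₁ := b₁ ((τ - t₀) / L)) (ξ₂ := b₂ ((τ - t₀) / L)) hM hα (Nat.cast_nonneg _) hR hL hLε
    (by positivity) hu2 (Real.exp_pos _).le (hw τ hτ) (hκ τ hτ) (hb.abs_le_one _) (hb.abs_le₁ _)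
    (hb.abs_le₂ _) (hb.abs_le_one _) (hb.abs_le₁ _) (hb.abs_le₂ _)
  have hT0 : 0 ≤ coeff δ δ' s * s ^ (-(2 + α)) := by
    rw [coeff]
    positivity
  refine le_trans (le_of_eq ?_) (mul_le_mul_of_nonneg_right hbound hT0)
  rw [← abs_of_nonneg hT0, ← abs_mul, ← abs_neg, htf, hwt, hbd, hTs,
    div_eq_mul_inv (coeff δ δ' s), hs2', hexpτ]
  congr 1
  simp only [X, X', X'', Y, Y', Y'']
  -- Only the terms along `V` lack the factor `s^(-2)`; it is extracted by `s^(-2) s² = 1`.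
  linear_combination (-(coeff δ δ' s * Real.exp (-α * τ) * b ((τ - t₀) / L) *
    (4 * u * (b₂ (u / R ^ 2) / R ^ 2 / R ^ 2) +
      2 * (Module.finrank ℝ V) * (b₁ (u / R ^ 2) / R ^ 2)))) * hs2

end TestFunction

end Rellich

/-! ### Upper bounds from flat pieces. -/

namespace Rellich

open Metric Topology RealInnerProductSpace

/-- Convexity at the combination `(1-θ)(x/(1-θ)) + θ(y/θ)`. The factor of the main term tends to `1`
as `θ → 0`, while the small error absorbs the large factor `θ^(1-p)`. -/
theorem add_rpow_le_weighted {p θ x y : ℝ} (hp : 1 ≤ p) (hθ : 0 < θ) (hθ1 : θ < 1) (hx : 0 ≤ x)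
    (hy : 0 ≤ y) : (x + y) ^ p ≤ (1 - θ) ^ (1 - p) * x ^ p + θ ^ (1 - p) * y ^ p := by
  have h1 : 0 < 1 - θ := by linarith
  have h := (convexOn_rpow hp).2 (mem_Ici.2 (div_nonneg hx h1.le)) (mem_Ici.2 (div_nonneg hy hθ.le))
    h1.le hθ.le (by ring)
  simp only [smul_eq_mul] at h
  rw [mul_div_cancel₀ _ h1.ne', mul_div_cancel₀ _ hθ.ne', Real.div_rpow hx h1.le,
    Real.div_rpow hy hθ.le] at h
  refine h.trans (le_of_eq ?_)
  rw [Real.rpow_sub h1, Real.rpow_sub hθ, Real.rpow_one, Real.rpow_one]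
  ring

/-- The relation for `α` makes the `p`-th power of the profile comparable to `s^(-a)`, the
borderline integrand of `integral_layer`. -/
theorem rpow_mul_rpow_bounds {p B σ α a c s : ℝ} (hp : 0 < p) (hB : 0 < B) (hs : 0 < s)
    (hc : 0 ≤ c) (hα : p * (2 + α - σ) = a) (h1 : c ≤ B * s ^ σ) (h2 : s ^ σ ≤ B * c) :
    (c * s ^ (-(2 + α))) ^ p ≤ B ^ p * s ^ (-a) ∧
      s ^ (-a) ≤ B ^ p * (c * s ^ (-(2 + α))) ^ p := by
  have e : s ^ (-a) = (s ^ σ * s ^ (-(2 + α))) ^ p := by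
    rw [← Real.rpow_add hs, ← Real.rpow_mul hs.le, ← hα]
    congr 1
    ring
  have h0 : 0 ≤ s ^ (-(2 + α)) := Real.rpow_nonneg hs.le _
  have hσ : 0 ≤ s ^ σ := Real.rpow_nonneg hs.le _
  rw [e, ← Real.mul_rpow hB.le (by positivity), ← Real.mul_rpow hB.le (by positivity)]
  constructor
  · refine Real.rpow_le_rpow (by positivity) ?_ hp.le
    rw [← mul_assoc]
    gcongr
  · refine Real.rpow_le_rpow (by positivity) ?_ hp.le
    rw [← mul_assoc]
    gcongr

variable {d : ℕ} {V : Submodule ℝ (Space d)} {x₀ : Space d} {K : Set (Space d)}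
  {b b₁ b₂ : ℝ → ℝ} {M α R t₀ L δ δ' σ ε B p θ : ℝ}

theorem testFn_ne_zero (hb : IsCutoff b b₁ b₂ M) (hR : 0 < R) (hL : 0 < L)
    (hV : 0 < Module.finrank ℝ Vᗮ) : testFn V x₀ b α R t₀ L ≠ 0 := by
  have hnt : Nontrivial Vᗮ := Module.finrank_pos_iff.1 hV
  obtain ⟨v, hv⟩ := exists_norm_eq Vᗮ (Real.exp_pos t₀).le
  have h1 : compNorm Vᗮ x₀ (x₀ + v) = Real.exp t₀ := by
    rw [compNorm, add_sub_cancel_left, Submodule.starProjection_eq_self_iff.2 v.2]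
    exact hv
  have h2 : compNorm V x₀ (x₀ + v) = 0 := by
    rw [compNorm, add_sub_cancel_left, (Submodule.starProjection_apply_eq_zero_iff V).2 v.2,
      norm_zero]
  intro h
  have h3 := testFn_eq_of_mem_layer (V := V) (x₀ := x₀) (α := α) (t₀ := t₀) hb hR hL
    (x := x₀ + v) ⟨by rw [h2]; exact hR.le, by
      rw [h1]
      constructor <;> exact Real.exp_le_exp.2 (by linarith)⟩
  rw [h] at h3
  exact (Real.exp_pos _).ne h3

/-- The error lives on the support shell and the denominator is bounded below on the smaller shell
where the cutoffs equal `1`. Their integrals have a ratio independent of `R` and `L`, so a pointwise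
error of size `ε` stays small in the quotient. -/
theorem nu_le_of_flat {P : Space d → Space d} (hP : IsNearestPointMap K P) (hK : IsClosed K)
    (hp : 1 < p) (hθ : 0 < θ) (hθ1 : θ < 1) (hV : 0 < Module.finrank ℝ Vᗮ)
    (hb : IsCutoff b b₁ b₂ M) (hR : 0 < R) (hL : 1 ≤ L)
    (ht : 2 * L ≤ |t₀|) (hα : 0 ≤ α) (hball : ∀ z ∈ V, ‖z‖ ≤ 2 * R → x₀ + z ∈ K)
    (hsub : ∀ y ∈ K, y - x₀ ∈ V) (hLε : 1 / L ≤ ε)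
    (hκ : ∀ t ∈ Icc (t₀ - 2 * L) (t₀ + 2 * L),
      |δ + (δ' - δ) * Real.exp t / (1 + Real.exp t) - σ| ≤ ε)
    (hw : ∀ t ∈ Icc (t₀ - 2 * L) (t₀ + 2 * L), Real.exp (2 * t) ≤ ε * R ^ 2)
    (hB : 0 < B)
    (hc : ∀ s ∈ Icc (Real.exp (t₀ - 2 * L)) (Real.exp (t₀ + 2 * L)),
      coeff δ δ' s ≤ B * s ^ σ ∧ s ^ σ ≤ B * coeff δ δ' s)
    (hαp : p * (2 + α - σ) = Module.finrank ℝ Vᗮ)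
    (hC : 0 ≤ (Module.finrank ℝ Vᗮ : ℝ) - 2 + σ - α) :
    nu p δ δ' K ≤ (1 - θ) ^ (1 - p) * (α * ((Module.finrank ℝ Vᗮ : ℝ) - 2 + σ - α)) ^ p +
      θ ^ (1 - p) * (errConst M α (Module.finrank ℝ Vᗮ) (Module.finrank ℝ V) σ * ε) ^ p *
        (B ^ p * (2 * √2 ^ Module.finrank ℝ V) * B ^ p) := by
  have hp0 : 0 < p := by linarith
  have hL0 : 0 < L := by linarith
  have hε : 0 ≤ ε := le_trans (by positivity) hLε
  have hM : 0 ≤ M := (abs_nonneg _).trans (hb.abs_le₁ 0)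
  have h1θ : 0 < 1 - θ := by linarith
  set a : ℝ := (Module.finrank ℝ Vᗮ : ℝ)
  set C := α * (a - 2 + σ - α)
  have hC0 : 0 ≤ C := mul_nonneg hα hC
  set E := errConst M α a (Module.finrank ℝ V) σ
  have hE : 0 ≤ E := by
    simp only [E, errConst]
    positivity
  set φ := testFn V x₀ b α R t₀ L
  have hφ : IsTest (domain K) φ := isTest_testFn hb hR hL0 ht hsub
  have hφne : φ ≠ 0 := testFn_ne_zero hb hR hL0 hV
  set Φ : Space d → ℝ := fun x => weight δ δ' K x / bdryDist K x ^ 2 * φ x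
  have hDpos : 0 < ∫ x in domain K, |Φ x| ^ p :=
    integral_weight_div_sq_mul_pos hP hK δ δ' hp0 hφ hφne
  have hΩ : tsupport φ ⊆ domain K := hφ.2.2
  have hφ0 : ∀ x ∉ tsupport φ, φ x = 0 := fun x hx => image_eq_zero_of_notMem_tsupport hx
  have eD : ∫ x in domain K, |Φ x| ^ p = ∫ x, |Φ x| ^ p :=
    setIntegral_eq_integral_of_forall_compl_eq_zero fun x hx => by
      simp only [Φ]
      rw [hφ0 x fun h => hx (hΩ h), mul_zero, abs_zero, Real.zero_rpow hp0.ne']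
  have eN : ∫ x in domain K, |H δ δ' K φ x| ^ p = ∫ x, |H δ δ' K φ x| ^ p :=
    setIntegral_eq_integral_of_forall_compl_eq_zero fun x hx => by
      rw [H_eq_zero_of_notMem_tsupport fun h => hx (hΩ h), abs_zero, Real.zero_rpow hp0.ne']
  have hDpos' := hDpos
  rw [eD] at hDpos'
  -- The integral of a non-integrable function is `0` by convention, which contradicts positivity.
  have iD : Integrable fun x => |Φ x| ^ p := by
    by_contra h
    rw [integral_undef h] at hDpos'
    exact lt_irrefl _ hDpos'
  refine (csInf_le ⟨0, bddBelow_quotients p δ δ' K⟩ ⟨φ, hφ, hφne, rfl⟩).trans ?_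
  rw [div_le_iff₀ hDpos, eN, eD]
  set S := layer V x₀ (√2 * R) (Real.exp (t₀ - 2 * L)) (Real.exp (t₀ + 2 * L))
  set S' := layer V x₀ R (Real.exp (t₀ - L)) (Real.exp (t₀ + L))
  set s : Space d → ℝ := compNorm Vᗮ x₀
  set I := ∫ x in S, s x ^ (-a)
  set I' := ∫ x in S', s x ^ (-a)
  -- The logarithmic widths are `4L` and `2L`, the radii along `V` are `√2 R` and `R`.
  have hII : I = 2 * √2 ^ Module.finrank ℝ V * I' := by
    obtain ⟨c, -, hc⟩ := integral_layer V hV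
    simp only [I, I', S, S', s, a]
    rw [hc _ _ _ _ (by positivity) (Real.exp_pos _) (Real.exp_le_exp.2 (by linarith)),
      hc _ _ _ _ hR.le (Real.exp_pos _) (Real.exp_le_exp.2 (by linarith)), ← Real.exp_sub,
      ← Real.exp_sub, Real.log_exp, Real.log_exp, mul_pow]
    ring
  have hmS : MeasurableSet S := (isClosed_layer _ _ _ _ _).measurableSet
  have hmS' : MeasurableSet S' := (isClosed_layer _ _ _ _ _).measurableSet
  have iS : Integrable (S.indicator fun x => s x ^ (-a)) :=
    (integrable_indicator_iff hmS).2 (integrableOn_layer V x₀ _ (Real.exp_pos _) _ _)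
  have hcoeff : ∀ s : ℝ, 0 < s → 0 ≤ coeff δ δ' s := fun s hs => by
    rw [coeff]
    positivity
  have hΦ : I' ≤ B ^ p * ∫ x, |Φ x| ^ p := by
    simp only [I']
    rw [← integral_indicator hmS', ← integral_const_mul]
    refine integral_mono_of_nonneg (Eventually.of_forall fun x => ?_) (iD.const_mul _)
      (Eventually.of_forall fun x => ?_)
    · exact indicator_nonneg (fun x _ => Real.rpow_nonneg (compNorm_nonneg _ _ _) _) x
    · refine indicator_le' (f := fun x => s x ^ (-a)) (g := fun x => B ^ p * |Φ x| ^ p)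
        (fun x hx => ?_) (fun x _ => by positivity) x
      have hs : 0 < s x := (Real.exp_pos _).trans_le hx.2.1
      have hd : bdryDist K x = s x := by
        rw [bdryDist_eq]
        exact infDist_eq_compNorm hball hsub (hx.1.trans (by linarith))
      have hsm : s x ∈ Icc (Real.exp (t₀ - 2 * L)) (Real.exp (t₀ + 2 * L)) :=
        ⟨le_trans (Real.exp_le_exp.2 (by linarith)) hx.2.1,
          hx.2.2.trans (Real.exp_le_exp.2 (by linarith))⟩
      have hval : |Φ x| = coeff δ δ' (s x) * s x ^ (-(2 + α)) := by
        have : Φ x = coeff δ δ' (s x) * s x ^ (-(2 + α)) := by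
          simp only [Φ, φ]
          have e2 : s x ^ (-2 : ℝ) = (s x ^ 2)⁻¹ := by rw [Real.rpow_neg hs.le, Real.rpow_two]
          rw [testFn_eq_of_mem_layer hb hR hL0 hx, weight, hd, mul_comm (-α),
            ← Real.rpow_def_of_pos hs, neg_add, Real.rpow_add hs, e2]
          ring
        rw [this, abs_of_nonneg (mul_nonneg (hcoeff _ hs) (Real.rpow_nonneg hs.le _))]
      rw [hval]
      exact (rpow_mul_rpow_bounds hp0 hB hs (hcoeff _ hs) hαp (hc _ hsm).1 (hc _ hsm).2).2
  have hpt : ∀ x, |H δ δ' K φ x| ^ p ≤ (1 - θ) ^ (1 - p) * C ^ p * |Φ x| ^ p +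
      θ ^ (1 - p) * (E * ε) ^ p * B ^ p * S.indicator (fun x => s x ^ (-a)) x := by
    intro x
    have hind : 0 ≤ S.indicator (fun x => s x ^ (-a)) x :=
      indicator_nonneg (fun x _ => Real.rpow_nonneg (compNorm_nonneg _ _ _) _) x
    by_cases hx : x ∈ tsupport φ
    · have hxS : x ∈ S := tsupport_testFn_subset hb hR hL0 ht hx
      have hs : 0 < s x := (Real.exp_pos _).trans_le hxS.2.1
      have hbd : |H δ δ' K φ x - C * Φ x| ≤ E * ε * (coeff δ δ' (s x) * s x ^ (-(2 + α))) :=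
        abs_H_testFn_sub_le hb hR hL ht hα hball hsub hLε hκ hw hx
      have hT := (rpow_mul_rpow_bounds hp0 hB hs (hcoeff _ hs) hαp (hc _ hxS.2).1
        (hc _ hxS.2).2).1
      rw [indicator_of_mem hxS]
      have hT0 : 0 ≤ coeff δ δ' (s x) * s x ^ (-(2 + α)) :=
        mul_nonneg (hcoeff _ hs) (Real.rpow_nonneg hs.le _)
      calc |H δ δ' K φ x| ^ p
          ≤ (C * |Φ x| + E * ε * (coeff δ δ' (s x) * s x ^ (-(2 + α)))) ^ p := by
            refine Real.rpow_le_rpow (abs_nonneg _) ?_ hp0.le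
            have := abs_add_le (C * Φ x) (H δ δ' K φ x - C * Φ x)
            rw [add_sub_cancel, abs_mul, abs_of_nonneg hC0] at this
            linarith
        _ ≤ (1 - θ) ^ (1 - p) * (C * |Φ x|) ^ p +
            θ ^ (1 - p) * (E * ε * (coeff δ δ' (s x) * s x ^ (-(2 + α)))) ^ p :=
            add_rpow_le_weighted hp.le hθ hθ1 (by positivity) (by positivity)
        _ ≤ (1 - θ) ^ (1 - p) * (C ^ p * |Φ x| ^ p) +
            θ ^ (1 - p) * ((E * ε) ^ p * (B ^ p * s x ^ (-a))) := by
            rw [Real.mul_rpow hC0 (abs_nonneg _), Real.mul_rpow (by positivity) hT0]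
            gcongr
        _ = _ := by ring
    · rw [H_eq_zero_of_notMem_tsupport hx, abs_zero, Real.zero_rpow hp0.ne']
      positivity
  have hN := integral_mono_of_nonneg
    (Eventually.of_forall fun x => Real.rpow_nonneg (abs_nonneg (H δ δ' K φ x)) p)
    ((iD.const_mul ((1 - θ) ^ (1 - p) * C ^ p)).add
      (iS.const_mul (θ ^ (1 - p) * (E * ε) ^ p * B ^ p)))
    (Eventually.of_forall hpt)
  have hsum : ∫ x, ((fun x => (1 - θ) ^ (1 - p) * C ^ p * |Φ x| ^ p) +
      fun x => θ ^ (1 - p) * (E * ε) ^ p * B ^ p * S.indicator (fun x => s x ^ (-a)) x) x =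
      (1 - θ) ^ (1 - p) * C ^ p * (∫ x, |Φ x| ^ p) +
        θ ^ (1 - p) * (E * ε) ^ p * B ^ p * I := by
    rw [integral_add' (iD.const_mul _) (iS.const_mul _), integral_const_mul, integral_const_mul,
      integral_indicator hmS]
  rw [hsum, hII] at hN
  refine hN.trans ?_
  have hmul : θ ^ (1 - p) * (E * ε) ^ p * B ^ p * (2 * √2 ^ Module.finrank ℝ V * I') ≤
      θ ^ (1 - p) * (E * ε) ^ p * B ^ p * (2 * √2 ^ Module.finrank ℝ V *
        (B ^ p * ∫ x, |Φ x| ^ p)) := by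
    gcongr
  linarith

/-- Let `ε → 0`, then `θ → 0`. The constant `B` must not depend on `ε`, while the flat piece and all
scales may. -/
theorem nu_le_of_forall_flat {P : Space d → Space d} (hP : IsNearestPointMap K P)
    (hK : IsClosed K) (hp : 1 < p) (hV : 0 < Module.finrank ℝ Vᗮ)
    (hA : 0 ≤ (Module.finrank ℝ Vᗮ : ℝ) + p * σ - 2 * p) (hB : 0 < B)
    (h : ∀ ε > 0, ∃ x₀ : Space d, ∃ R t₀ L : ℝ, 0 < R ∧ 1 ≤ L ∧ 2 * L ≤ |t₀| ∧
      (∀ z ∈ V, ‖z‖ ≤ 2 * R → x₀ + z ∈ K) ∧ (∀ y ∈ K, y - x₀ ∈ V) ∧ 1 / L ≤ ε ∧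
      (∀ t ∈ Icc (t₀ - 2 * L) (t₀ + 2 * L),
        |δ + (δ' - δ) * Real.exp t / (1 + Real.exp t) - σ| ≤ ε ∧
        Real.exp (2 * t) ≤ ε * R ^ 2) ∧
      ∀ s ∈ Icc (Real.exp (t₀ - 2 * L)) (Real.exp (t₀ + 2 * L)),
        coeff δ δ' s ≤ B * s ^ σ ∧ s ^ σ ≤ B * coeff δ δ' s) :
    nu p δ δ' K ≤ ((p - 1) * (Module.finrank ℝ Vᗮ : ℝ) *
      ((Module.finrank ℝ Vᗮ : ℝ) + p * σ - 2 * p) / p ^ 2) ^ p := by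
  have hp0 : 0 < p := by linarith
  obtain ⟨b, b₁, b₂, M, hb⟩ := exists_isCutoff
  set a : ℝ := (Module.finrank ℝ Vᗮ : ℝ) with ha
  have ha0 : 0 < a := Nat.cast_pos.2 hV
  set α := (a + p * σ - 2 * p) / p with hα
  have hα0 : 0 ≤ α := div_nonneg hA hp0.le
  have hαp : p * (2 + α - σ) = a := by rw [hα]; field_simp; ring
  have hC : a - 2 + σ - α = (p - 1) * a / p := by rw [hα]; field_simp; ring
  have hC0 : 0 ≤ a - 2 + σ - α := by
    rw [hC]
    exact div_nonneg (mul_nonneg (by linarith) ha0.le) hp0.le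
  have hconst : (p - 1) * a * (a + p * σ - 2 * p) / p ^ 2 = α * (a - 2 + σ - α) := by
    rw [hC, hα]
    field_simp
  rw [hconst]
  set C := α * (a - 2 + σ - α)
  have hkey : ∀ θ ε : ℝ, 0 < θ → θ < 1 → 0 < ε → nu p δ δ' K ≤ (1 - θ) ^ (1 - p) * C ^ p +
      θ ^ (1 - p) * (errConst M α a (Module.finrank ℝ V) σ * ε) ^ p *
        (B ^ p * (2 * √2 ^ Module.finrank ℝ V) * B ^ p) := by
    intro θ ε hθ hθ1 hε
    obtain ⟨x₀, R, t₀, L, hR, hL, ht, hball, hsub, hLε, hκw, hc⟩ := h ε hε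
    exact nu_le_of_flat hP hK hp hθ hθ1 hV hb hR hL ht hα0 hball hsub hLε
      (fun t ht => (hκw t ht).1) (fun t ht => (hκw t ht).2) hB hc hαp hC0
  have hθ : ∀ θ : ℝ, 0 < θ → θ < 1 → nu p δ δ' K ≤ (1 - θ) ^ (1 - p) * C ^ p := by
    intro θ hθ hθ1
    have hcont : Continuous fun ε : ℝ => (1 - θ) ^ (1 - p) * C ^ p +
        θ ^ (1 - p) * (errConst M α a (Module.finrank ℝ V) σ * ε) ^ p *
          (B ^ p * (2 * √2 ^ Module.finrank ℝ V) * B ^ p) := by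
      have : Continuous fun ε : ℝ => (errConst M α a (Module.finrank ℝ V) σ * ε) ^ p :=
        (continuous_const.mul continuous_id).rpow_const fun _ => Or.inr hp0.le
      fun_prop
    have hlim := (hcont.tendsto 0).mono_left (nhdsWithin_le_nhds (s := Ioi 0))
    simp only [mul_zero, Real.zero_rpow hp0.ne', zero_mul, add_zero] at hlim
    exact ge_of_tendsto hlim (eventually_nhdsWithin_of_forall fun ε hε => hkey θ ε hθ hθ1 hε)
  have hcont : ContinuousAt (fun θ : ℝ => (1 - θ) ^ (1 - p) * C ^ p) 0 := by
    refine ContinuousAt.mul (ContinuousAt.rpow_const (by fun_prop) (Or.inl (by simp))) ?_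
    exact continuousAt_const
  have hlim := hcont.tendsto.mono_left (nhdsWithin_le_nhds (s := Ioi 0))
  simp only [sub_zero, Real.one_rpow, one_mul] at hlim
  refine ge_of_tendsto hlim ?_
  filter_upwards [Ioo_mem_nhdsGT (zero_lt_one' ℝ)] with θ hθ'
  exact hθ θ hθ'.1 hθ'.2

end Rellich

namespace Rellich

open Metric Topology RealInnerProductSpace

/-! ### Large flat balls in convex sets of full dimension at infinity. -/

section Inradius

variable {W : Type*} [NormedAddCommGroup W] [InnerProductSpace ℝ W]

/-- If a convex set contains the points `x ± t b i` for an orthonormal basis `b` of `n` vectors,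
then it contains the ball of radius `t / n` around `x`. -/
theorem add_mem_of_forall_add_smul_mem {n : ℕ} (hn : 0 < n) (b : OrthonormalBasis (Fin n) ℝ W)
    {C : Set W} (hC : Convex ℝ C) {t : ℝ} (ht : 0 < t) {x : W}
    (h : ∀ i, x + t • b i ∈ C ∧ x + (-t) • b i ∈ C) {z : W} (hz : ‖z‖ ≤ t / n) : x + z ∈ C := by
  have hn' : (0 : ℝ) < n := Nat.cast_pos.2 hn
  have h1 : ∀ i (c : ℝ), |c| ≤ t → x + c • b i ∈ C := by
    intro i c hc
    rw [abs_le] at hc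
    have := hC (h i).1 (h i).2 (a := (t + c) / (2 * t)) (b := (t - c) / (2 * t))
      (div_nonneg (by linarith) (by linarith)) (div_nonneg (by linarith) (by linarith))
      (by field_simp; ring)
    convert this using 1
    rw [smul_add, smul_add, smul_smul, smul_smul, add_add_add_comm, ← add_smul, ← add_smul]
    have e1 : (t + c) / (2 * t) + (t - c) / (2 * t) = 1 := by field_simp; ring
    have e2 : (t + c) / (2 * t) * t + (t - c) / (2 * t) * -t = c := by field_simp; ring
    rw [e1, e2, one_smul]
  -- `x + z` is the mean of the points `x + n⟪b i, z⟫ b i`, one on each axis; `‖z‖ ≤ t / n` keeps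
  -- them within distance `t` of `x`.
  have h2 : ∑ i, (1 / n : ℝ) • (x + (n * ⟪b i, z⟫) • b i) ∈ C := by
    refine hC.sum_mem (fun i _ => by positivity) (by simp [hn'.ne']) fun i _ => h1 i _ ?_
    have hi := abs_real_inner_le_norm (b i) z
    rw [b.orthonormal.1 i, one_mul] at hi
    rw [abs_mul, abs_of_pos hn']
    rw [le_div_iff₀ hn'] at hz
    nlinarith
  convert h2 using 1
  simp_rw [smul_add, smul_smul]
  rw [Finset.sum_add_distrib, Finset.sum_const, Finset.card_univ, Fintype.card_fin,
    ← Nat.cast_smul_eq_nsmul ℝ, smul_smul, mul_one_div_cancel hn'.ne', one_smul]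
  congr 1
  conv_lhs => rw [← b.sum_repr' z]
  refine Finset.sum_congr rfl fun i _ => ?_
  congr 1
  field_simp

variable [FiniteDimensional ℝ W] [MeasurableSpace W] [BorelSpace W]

/-- The points of a bounded convex set that leave it under a given translation form a small set,
as sufficiently many translates of that set are disjoint. -/
theorem measure_add_notMem_le {C : Set W} (hC : Convex ℝ C) (hcl : IsClosed C) {t s : ℝ}
    (ht : 0 < t) (hts : t ≤ s) {u : W} (hu : ‖u‖ = t) :
    volume {x | x ∈ C ∧ x ∈ ball (0 : W) s ∧ x + u ∉ C} ≤
      ENNReal.ofReal (3 ^ Module.finrank ℝ W * t * s ^ Module.finrank ℝ W / s) *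
        volume (ball (0 : W) 1) := by
  have hs : 0 < s := ht.trans_le hts
  set n := Module.finrank ℝ W
  set A : Set W := {x | x ∈ C ∧ x ∈ ball (0 : W) s ∧ x + u ∉ C}
  have hA : MeasurableSet A := by
    refine hcl.measurableSet.inter (measurableSet_ball.inter ?_)
    exact (hcl.measurableSet.preimage (measurable_id.add_const u)).compl
  -- The shifts by `j u` with `j < N` have length at most `s`, so all `N` translates stay in a ball
  -- of radius `3s`.
  set N := ⌈s / t⌉₊
  have hN1 : s / t ≤ N := Nat.le_ceil _
  have hN2 : (N : ℝ) ≤ s / t + 1 := (Nat.ceil_lt_add_one (by positivity)).le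
  let T : ℕ → Set W := fun j => (fun x => x + -((j : ℝ) • u)) ⁻¹' A
  have hTm : ∀ j, MeasurableSet (T j) := fun j => hA.preimage (measurable_id.add_const _)
  have hTv : ∀ j, volume (T j) = volume A := fun j => measure_preimage_add_right _ _ _
  have hlt : ∀ i j : ℕ, i < j → Disjoint (T i) (T j) := by
    intro i j hij
    rw [Set.disjoint_left]
    intro x hxi hxj
    have hi : x + -((i : ℝ) • u) ∈ C := hxi.1
    have hj : x + -((j : ℝ) • u) ∈ C := hxj.1
    refine hxj.2.2 ?_
    have hm : (1 : ℝ) ≤ (j : ℝ) - i := by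
      have : (i : ℝ) + 1 ≤ j := by exact_mod_cast hij
      linarith
    have hm0 : (0 : ℝ) < (j : ℝ) - i := by linarith
    -- If `x - ju` and `x - iu` are both in `C` with `i < j`, the segment between them contains `x -
    -- ju + u`, which the definition of `A` excludes.
    have := hC hj hi (a := 1 - 1 / ((j : ℝ) - i)) (b := 1 / ((j : ℝ) - i))
      (by rw [sub_nonneg, div_le_one hm0]; exact hm) (by positivity) (by ring)
    convert this using 1
    rw [smul_add, smul_add, smul_neg, smul_neg, smul_smul, smul_smul, add_add_add_comm, ← add_smul,
      sub_add_cancel, one_smul, add_assoc]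
    congr 1
    rw [← neg_smul, ← neg_smul, ← neg_smul, ← add_smul]
    conv_lhs => rw [← one_smul ℝ u, smul_smul, ← add_smul]
    congr 1
    field_simp
    ring
  have hdisj : (↑(Finset.range N) : Set ℕ).PairwiseDisjoint T := by
    intro i _ j _ hij
    rcases lt_or_gt_of_ne hij with h | h
    · exact hlt i j h
    · exact (hlt j i h).symm
  have hsub : (⋃ j ∈ Finset.range N, T j) ⊆ ball (0 : W) (3 * s) := by
    intro x hx
    simp only [mem_iUnion] at hx
    obtain ⟨j, hj, hxj⟩ := hx
    have h1 : ‖x + -((j : ℝ) • u)‖ < s := by simpa using hxj.2.1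
    have hj' : (j : ℝ) + 1 ≤ N := by exact_mod_cast Finset.mem_range.1 hj
    have h2 : ‖(j : ℝ) • u‖ ≤ s := by
      rw [norm_smul, hu, Real.norm_of_nonneg (Nat.cast_nonneg _)]
      have : (j : ℝ) ≤ s / t := by linarith
      rwa [le_div_iff₀ ht] at this
    rw [mem_ball_zero_iff]
    calc ‖x‖ = ‖(x + -((j : ℝ) • u)) + (j : ℝ) • u‖ := by rw [neg_add_cancel_right]
      _ ≤ ‖x + -((j : ℝ) • u)‖ + ‖(j : ℝ) • u‖ := norm_add_le _ _
      _ < 3 * s := by linarith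
  have hmeas := measure_mono (μ := volume) hsub
  rw [measure_biUnion_finset hdisj fun j _ => hTm j] at hmeas
  simp only [hTv, Finset.sum_const, Finset.card_range, nsmul_eq_mul] at hmeas
  rw [Measure.addHaar_ball_of_pos _ _ (by positivity)] at hmeas
  have hN0 : (0 : ℝ) < N := lt_of_lt_of_le (by positivity) hN1
  have hN0' : (N : ℝ≥0∞) ≠ 0 := by
    simpa using (Nat.cast_pos.1 hN0).ne'
  calc volume A ≤ ENNReal.ofReal ((3 * s) ^ n) * volume (ball (0 : W) 1) / N :=
        (ENNReal.le_div_iff_mul_le (Or.inl hN0') (Or.inl (ENNReal.natCast_ne_top N))).2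
          (by rwa [mul_comm])
    _ = ENNReal.ofReal ((3 * s) ^ n / N) * volume (ball (0 : W) 1) := by
        rw [ENNReal.ofReal_div_of_pos hN0, ENNReal.ofReal_natCast, ENNReal.mul_div_right_comm]
    _ ≤ _ := by
        gcongr ENNReal.ofReal ?_ * _
        rw [div_le_div_iff₀ hN0 hs, mul_pow]
        rw [div_le_iff₀ ht] at hN1
        have : 0 ≤ 3 ^ n * s ^ n := by positivity
        nlinarith

/-- A closed convex set that contains no ball of radius `ρ` has the growth of a set of smaller
dimension. -/
theorem exists_measure_inter_ball_le {C : Set W} (hC : Convex ℝ C) (hcl : IsClosed C)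
    (hn : 0 < Module.finrank ℝ W) {ρ : ℝ} (hρ : 0 < ρ)
    (hno : ∀ x ∈ C, ∃ z : W, ‖z‖ ≤ ρ ∧ x + z ∉ C) :
    ∃ A s₀ : ℝ, 0 ≤ A ∧ ∀ s, s₀ ≤ s → volume (C ∩ ball 0 s) ≤
      ENNReal.ofReal (A * (s ^ Module.finrank ℝ W / s)) := by
  set n := Module.finrank ℝ W
  have hn' : (0 : ℝ) < n := Nat.cast_pos.2 hn
  let b := stdOrthonormalBasis ℝ W
  -- Then the ball of radius `t / n = ρ` is excluded, so every point of `C` leaves `C` under one of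
  -- the `2n` shifts `±t b i`.
  set t := ρ * n with ht_def
  have ht : 0 < t := mul_pos hρ hn'
  set ω := volume.real (ball (0 : W) 1)
  have hω : volume (ball (0 : W) 1) = ENNReal.ofReal ω :=
    (ENNReal.ofReal_toReal measure_ball_lt_top.ne).symm
  have hω0 : 0 ≤ ω := measureReal_nonneg
  refine ⟨2 * n * (3 ^ n * t * ω), t, by positivity, fun s hs => ?_⟩
  have hs0 : 0 < s := ht.trans_le hs
  let D : Fin n → Set W := fun i => {x | x ∈ C ∧ x ∈ ball (0 : W) s ∧ x + t • b i ∉ C} ∪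
    {x | x ∈ C ∧ x ∈ ball (0 : W) s ∧ x + (-t) • b i ∉ C}
  have hcover : C ∩ ball 0 s ⊆ ⋃ i, D i := by
    intro x hx
    by_contra hx'
    simp only [mem_iUnion, D, mem_union, mem_ofPred_eq, not_exists, not_or, not_and, not_not] at hx'
    obtain ⟨z, hz, hxz⟩ := hno x hx.1
    refine hxz (add_mem_of_forall_add_smul_mem hn b hC ht (fun i =>
      ⟨(hx' i).1 hx.1 hx.2, (hx' i).2 hx.1 hx.2⟩) ?_)
    rwa [ht_def, mul_div_cancel_right₀ _ hn'.ne']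
  have hone : ∀ u : W, ‖u‖ = t → volume {x | x ∈ C ∧ x ∈ ball (0 : W) s ∧ x + u ∉ C} ≤
      ENNReal.ofReal (3 ^ n * t * ω * (s ^ n / s)) := by
    intro u hu
    refine (measure_add_notMem_le hC hcl ht hs hu).trans (le_of_eq ?_)
    rw [hω, ← ENNReal.ofReal_mul (by positivity)]
    congr 1
    ring
  have hnorm : ∀ i (c : ℝ), |c| = t → ‖c • b i‖ = t := fun i c hc => by
    rw [norm_smul, b.orthonormal.1 i, mul_one, Real.norm_eq_abs, hc]
  calc volume (C ∩ ball 0 s) ≤ ∑ i, volume (D i) :=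
        (measure_mono hcover).trans (measure_iUnion_fintype_le _ _)
    _ ≤ ∑ _i : Fin n, (ENNReal.ofReal (3 ^ n * t * ω * (s ^ n / s)) +
          ENNReal.ofReal (3 ^ n * t * ω * (s ^ n / s))) :=
        Finset.sum_le_sum fun i _ => (measure_union_le _ _).trans (add_le_add
          (hone _ (hnorm i t (abs_of_pos ht)))
          (hone _ (hnorm i (-t) (by rw [abs_neg, abs_of_pos ht]))))
    _ = _ := by
        rw [Finset.sum_const, Finset.card_univ, Fintype.card_fin, nsmul_eq_mul,
          ← ENNReal.ofReal_add (by positivity) (by positivity), ← ENNReal.ofReal_natCast,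
          ← ENNReal.ofReal_mul (by positivity)]
        congr 1
        ring

end Inradius

theorem nonempty_of_one_le_dim {d : ℕ} {K : Set (Space d)} (hk : 1 ≤ dim K) :
    K.Nonempty := by
  by_contra h
  rw [not_nonempty_iff_eq_empty] at h
  rw [dim, h] at hk
  simp at hk

/-- Otherwise `|K ∩ B_r|` grows at most like `r^(k-1)`, which contradicts `k_∞ = k`. The set is
transported isometrically to the direction space, where the Hausdorff measure is Lebesgue measure.
-/
theorem exists_flat_ball_of_dimAtInfinity {d : ℕ} {K : Set (Space d)} (hK : IsClosed K)
    (hc : Convex ℝ K) (hk : 1 ≤ dim K) (hinf : dimAtInfinity K = (dim K : EReal)) {ρ : ℝ}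
    (hρ : 0 < ρ) :
    ∃ x₀ ∈ K, ∀ z ∈ (affineSpan ℝ K).direction, ‖z‖ ≤ ρ → x₀ + z ∈ K := by
  by_contra! hno
  set V := (affineSpan ℝ K).direction with hV
  have hdim : Module.finrank ℝ V = dim K := rfl
  obtain ⟨p₀, hp₀⟩ := nonempty_of_one_le_dim hk
  let f : V → Space d := fun v => p₀ + v
  have hf : Isometry f := by
    refine Isometry.of_dist_eq fun x y => ?_
    simp only [f, dist_add_left]
    rfl
  set C : Set V := f ⁻¹' K
  have hCcl : IsClosed C := hK.preimage hf.continuous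
  have hCc : Convex ℝ C := by
    have : C = V.subtype ⁻¹' ((fun x => p₀ + x) ⁻¹' K) := rfl
    rw [this]
    exact (hc.translate_preimage_right p₀).linear_preimage V.subtype
  have hnoC : ∀ x ∈ C, ∃ z : V, ‖z‖ ≤ ρ ∧ x + z ∉ C := by
    intro x hx
    obtain ⟨z, hz, hzρ, hzK⟩ := hno (p₀ + x) hx
    refine ⟨⟨z, hz⟩, hzρ, fun h => hzK ?_⟩
    have : p₀ + ((x : Space d) + z) ∈ K := h
    rwa [add_assoc]
  obtain ⟨A, s₀, hA, hAs⟩ := exists_measure_inter_ball_le hCc hCcl (hdim ▸ hk) hρ hnoC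
  rw [hdim] at hAs
  have hmeas : ∀ r, Measure.euclideanHausdorffMeasure (dim K) (K ∩ ball (0 : Space d) r) ≤
      volume (C ∩ ball 0 (r + ‖p₀‖)) := by
    intro r
    rw [← InnerProductSpace.euclideanHausdorffMeasure_eq_volume, hdim,
      ← hf.euclideanHausdorffMeasure_image]
    refine measure_mono fun x hx => ?_
    have hxV : x - p₀ ∈ V := AffineSubspace.vsub_mem_direction (subset_affineSpan ℝ K hx.1)
      (subset_affineSpan ℝ K hp₀)
    refine ⟨⟨x - p₀, hxV⟩, ⟨?_, ?_⟩, ?_⟩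
    · simp only [C, f, mem_preimage, add_sub_cancel]
      exact hx.1
    · rw [mem_ball_zero_iff]
      have h1 : ‖x‖ < r := by simpa using hx.2
      have h2 : ‖x - p₀‖ ≤ ‖x‖ + ‖p₀‖ := norm_sub_le x p₀
      exact lt_of_le_of_lt h2 (by linarith)
    · simp only [f, add_sub_cancel]
  -- The exponent `k - 1/2` lies between `k - 1` and `k`: the spare half power absorbs `A` and the
  -- shift of centre by `p₀`.
  have hev : ∀ᶠ r : ℝ in atTop,
      ENNReal.log (Measure.euclideanHausdorffMeasure (dim K) (K ∩ ball (0 : Space d) r)) /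
        (Real.log r : EReal) ≤ (((dim K : ℝ) - 1 / 2 : ℝ) : EReal) := by
    filter_upwards [eventually_ge_atTop s₀, eventually_ge_atTop ‖p₀‖, eventually_gt_atTop 1,
      eventually_ge_atTop ((A * 2 ^ dim K) ^ 2)] with r h0 h1 h2 h3
    have hr : 0 < r := by linarith
    have hlog : 0 < Real.log r := Real.log_pos h2
    rw [EReal.div_le_iff_le_mul (by exact_mod_cast hlog) (EReal.coe_ne_top _), ← EReal.coe_mul]
    have hbound : A * ((r + ‖p₀‖) ^ dim K / (r + ‖p₀‖)) ≤ r ^ ((dim K : ℝ) - 1 / 2) := by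
      have e1 : r ^ ((dim K : ℝ) - 1 / 2) = r ^ dim K / √r := by
        rw [Real.rpow_sub hr, Real.rpow_natCast, Real.sqrt_eq_rpow]
      have hsq : A * 2 ^ dim K ≤ √r := Real.le_sqrt_of_sq_le h3
      have hsr : 0 < √r := Real.sqrt_pos.2 hr
      rw [e1, le_div_iff₀ hsr]
      calc A * ((r + ‖p₀‖) ^ dim K / (r + ‖p₀‖)) * √r
          ≤ A * ((2 * r) ^ dim K / r) * √r := by
            gcongr
            · linarith
            · linarith [norm_nonneg p₀]
        _ = (A * 2 ^ dim K) * √r * (r ^ dim K / r) := by rw [mul_pow]; ring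
        _ ≤ √r * √r * (r ^ dim K / r) := by gcongr
        _ = r ^ dim K := by rw [Real.mul_self_sqrt hr.le]; field_simp
    have hpow : 0 < r ^ ((dim K : ℝ) - 1 / 2) := Real.rpow_pos_of_pos hr _
    calc ENNReal.log (Measure.euclideanHausdorffMeasure (dim K) (K ∩ ball (0 : Space d) r))
        ≤ ENNReal.log (ENNReal.ofReal (r ^ ((dim K : ℝ) - 1 / 2))) := by
          refine ENNReal.log_le_log ((hmeas r).trans ((hAs _ ?_).trans ?_))
          · linarith [norm_nonneg p₀]
          · exact ENNReal.ofReal_le_ofReal hbound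
      _ = _ := by
          rw [ENNReal.log_ofReal_of_pos hpow, Real.log_rpow hr, mul_comm]
  have hlim : dimAtInfinity K ≤ (((dim K : ℝ) - 1 / 2 : ℝ) : EReal) :=
    liminf_le_of_frequently_le' hev.frequently
  rw [hinf, show ((dim K : ℕ) : EReal) = ((dim K : ℝ) : EReal) by simp,
    EReal.coe_le_coe_iff] at hlim
  linarith

end Rellich

/-! ### Choice of scales and conclusion. -/

namespace Rellich

open Metric Topology RealInnerProductSpace

/-- Applied to `q = 1 + s` for `s ≤ 1` and to `q = (1 + s) / s` for `s ≥ 1`, it compares the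
coefficient with `s^δ` and with `s^δ'`. -/
theorem rpow_bounds_of_mem_Icc {q : ℝ} (hq : q ∈ Icc (1 : ℝ) 2) (e : ℝ) :
    q ^ e ≤ 2 ^ |e| ∧ 1 ≤ 2 ^ |e| * q ^ e := by
  have hq0 : 0 < q := one_pos.trans_le hq.1
  have key : ∀ e' : ℝ, q ^ e' ≤ 2 ^ |e'| := fun e' =>
    (Real.rpow_le_rpow_of_exponent_le hq.1 (le_abs_self e')).trans
      (Real.rpow_le_rpow hq0.le hq.2 (abs_nonneg e'))
  refine ⟨key e, ?_⟩
  have h := mul_le_mul_of_nonneg_right (key (-e)) (Real.rpow_nonneg hq0.le e)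
  rwa [← Real.rpow_add hq0, neg_add_cancel, Real.rpow_zero, abs_neg] at h

theorem coeff_bounds_of_le_one (δ δ' : ℝ) {s : ℝ} (hs : 0 < s) (hs1 : s ≤ 1) :
    coeff δ δ' s ≤ 2 ^ |δ' - δ| * s ^ δ ∧ s ^ δ ≤ 2 ^ |δ' - δ| * coeff δ δ' s := by
  obtain ⟨h1, h2⟩ := rpow_bounds_of_mem_Icc (q := 1 + s) ⟨by linarith, by linarith⟩ (δ' - δ)
  have h0 : 0 < s ^ δ := Real.rpow_pos_of_pos hs δ
  rw [coeff]
  constructor <;> nlinarith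

theorem coeff_bounds_of_one_le (δ δ' : ℝ) {s : ℝ} (hs1 : 1 ≤ s) :
    coeff δ δ' s ≤ 2 ^ |δ' - δ| * s ^ δ' ∧ s ^ δ' ≤ 2 ^ |δ' - δ| * coeff δ δ' s := by
  have hs : 0 < s := by linarith
  obtain ⟨h1, h2⟩ := rpow_bounds_of_mem_Icc (q := (1 + s) / s)
    ⟨by rw [le_div_iff₀ hs]; linarith, by rw [div_le_iff₀ hs]; linarith⟩ (δ' - δ)
  have h0 : 0 < s ^ δ' := Real.rpow_pos_of_pos hs δ'
  have e : coeff δ δ' s = s ^ δ' * ((1 + s) / s) ^ (δ' - δ) := by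
    have : s ^ δ' = s ^ δ * s ^ (δ' - δ) := by rw [← Real.rpow_add hs, add_sub_cancel]
    rw [coeff, this, mul_assoc, ← Real.mul_rpow hs.le (by positivity),
      mul_div_cancel₀ _ hs.ne']
  rw [e]
  constructor <;> nlinarith

theorem exists_length (D : ℝ) {ε η : ℝ} (hε : 0 < ε) (hη : 0 < η) :
    ∃ L : ℝ, 1 ≤ L ∧ 1 / L ≤ ε ∧ D * Real.exp (-L) ≤ ε ∧ Real.exp (-2 * L) ≤ η := by
  have hexp : Tendsto (fun L : ℝ => Real.exp (-L)) atTop (𝓝 0) :=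
    Real.tendsto_exp_neg_atTop_nhds_zero
  have h1 : Tendsto (fun L : ℝ => D * Real.exp (-L)) atTop (𝓝 0) := by
    simpa using hexp.const_mul D
  obtain ⟨L, h1, h2, h3, h4⟩ := ((eventually_ge_atTop (1 : ℝ)).and
    ((eventually_ge_atTop (1 / ε)).and ((h1.eventually_le_const hε).and
      (hexp.eventually_le_const hη)))).exists
  refine ⟨L, h1, ?_, h3, le_trans (Real.exp_le_exp.2 (by linarith)) h4⟩
  rw [div_le_iff₀ (by linarith)]
  rwa [div_le_iff₀ hε, mul_comm] at h2

variable {d : ℕ} {K : Set (Space d)}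

/-- A nonempty convex set in finite dimension has nonempty relative interior. -/
theorem exists_flat_ball (hc : Convex ℝ K) (hne : K.Nonempty) :
    ∃ x₀ ∈ K, ∃ ρ > 0, ∀ z ∈ (affineSpan ℝ K).direction, ‖z‖ ≤ ρ → x₀ + z ∈ K := by
  obtain ⟨x₀, y, hy, rfl⟩ := hne.intrinsicInterior hc
  obtain ⟨ρ, hρ, hball⟩ := Metric.isOpen_iff.1 isOpen_interior y hy
  refine ⟨y, (interior_subset hy : y ∈ ((↑) ⁻¹' K : Set (affineSpan ℝ K))), ρ / 2, half_pos hρ, fun z hz hzρ => ?_⟩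
  have hmem : (y : Space d) + z ∈ affineSpan ℝ K := by
    rw [add_comm]
    exact AffineSubspace.vadd_mem_of_mem_direction hz y.2
  have h : (⟨y + z, hmem⟩ : affineSpan ℝ K) ∈ ball y ρ := by
    rw [mem_ball, Subtype.dist_eq, dist_self_add_left]
    linarith
  exact (interior_subset (hball h) : _ ∈ ((↑) ⁻¹' K : Set (affineSpan ℝ K)))

theorem sub_mem_direction {x₀ : Space d} (hx₀ : x₀ ∈ K) :
    ∀ y ∈ K, y - x₀ ∈ (affineSpan ℝ K).direction := fun _ hy =>
  AffineSubspace.vsub_mem_direction (subset_affineSpan ℝ K hy) (subset_affineSpan ℝ K hx₀)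

theorem finrank_orthogonal_direction (K : Set (Space d)) :
    (Module.finrank ℝ (affineSpan ℝ K).directionᗮ : ℝ) = (d : ℝ) - dim K := by
  have h := (affineSpan ℝ K).direction.finrank_add_finrank_orthogonal
  rw [finrank_euclideanSpace_fin] at h
  rw [eq_sub_iff_add_eq', dim]
  exact_mod_cast h

theorem abs_mul_div_one_add_exp_le (D t : ℝ) :
    |D * Real.exp t / (1 + Real.exp t)| ≤ |D| * Real.exp t := by
  have h := Real.exp_pos t
  rw [abs_div, abs_mul, abs_of_pos h, abs_of_pos (by linarith : 0 < 1 + Real.exp t)]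
  exact div_le_self (by positivity) (by linarith)

theorem nu_le_local (hK : IsClosed K) (hc : Convex ℝ K) (hk : 1 ≤ dim K) (hkd : dim K < d)
    {p δ δ' : ℝ} (hp : 1 < p) (hA : 0 ≤ (d : ℝ) - dim K + p * δ - 2 * p) :
    nu p δ δ' K ≤
      ((p - 1) * ((d : ℝ) - dim K) * ((d : ℝ) - dim K + p * δ - 2 * p) / p ^ 2) ^ p := by
  have hne := nonempty_of_one_le_dim hk
  obtain ⟨P, hP⟩ := exists_isNearestPointMap hK hc hne
  obtain ⟨x₀, hx₀, ρ, hρ, hball⟩ := exists_flat_ball hc hne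
  have hfr := finrank_orthogonal_direction K
  have hV : 0 < Module.finrank ℝ (affineSpan ℝ K).directionᗮ := by
    have : (dim K : ℝ) < d := Nat.cast_lt.2 hkd
    rw [← Nat.cast_pos (α := ℝ), hfr]
    linarith
  rw [← hfr] at hA ⊢
  refine nu_le_of_forall_flat hP hK hp hV hA (B := 2 ^ |δ' - δ|) (by positivity) fun ε hε => ?_
  obtain ⟨L, hL, hLε, hD, hη⟩ := exists_length |δ' - δ| hε
    (by positivity : 0 < ε * (ρ / 2) ^ 2)
  -- The window in `log s` is `[-5L, -L]`: small scales above a fixed flat ball.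
  refine ⟨x₀, ρ / 2, -(3 * L), L, half_pos hρ, hL, ?_, ?_, sub_mem_direction hx₀, hLε, ?_, ?_⟩
  · rw [abs_neg, abs_of_pos (by linarith)]
    linarith
  · intro z hz hzρ
    exact hball z hz (by linarith)
  · rintro t ⟨-, ht⟩
    have ht' : t ≤ -L := by linarith
    constructor
    · rw [add_sub_cancel_left]
      refine (abs_mul_div_one_add_exp_le _ t).trans (le_trans ?_ hD)
      gcongr
    · exact le_trans (Real.exp_le_exp.2 (by linarith)) hη
  · rintro s ⟨hs, hs'⟩
    refine coeff_bounds_of_le_one δ δ' ((Real.exp_pos _).trans_le hs) (hs'.trans ?_)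
    exact Real.exp_le_one_iff.2 (by linarith)

theorem nu_le_of_dimAtInfinity (hK : IsClosed K) (hc : Convex ℝ K) (hk : 1 ≤ dim K)
    (hkd : dim K < d) (hinf : dimAtInfinity K = (dim K : EReal))
    {p δ δ' : ℝ} (hp : 1 < p) (hA : 0 ≤ (d : ℝ) - dim K + p * δ' - 2 * p) :
    nu p δ δ' K ≤
      ((p - 1) * ((d : ℝ) - dim K) * ((d : ℝ) - dim K + p * δ' - 2 * p) / p ^ 2) ^ p := by
  obtain ⟨P, hP⟩ := exists_isNearestPointMap hK hc (nonempty_of_one_le_dim hk)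
  have hfr := finrank_orthogonal_direction K
  have hV : 0 < Module.finrank ℝ (affineSpan ℝ K).directionᗮ := by
    have : (dim K : ℝ) < d := Nat.cast_lt.2 hkd
    rw [← Nat.cast_pos (α := ℝ), hfr]
    linarith
  rw [← hfr] at hA ⊢
  refine nu_le_of_forall_flat hP hK hp hV hA (B := 2 ^ |δ' - δ|) (by positivity) fun ε hε => ?_
  obtain ⟨L, hL, hLε, hD, hη⟩ := exists_length |δ' - δ| hε hε
  obtain ⟨x₀, hx₀, hball⟩ := exists_flat_ball_of_dimAtInfinity hK hc hk hinf
    (by positivity : 0 < 2 * Real.exp (6 * L))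
  -- The window is `[L, 5L]`, so `s² ≤ exp (10L) = exp (-2L) R²` with `R = exp (6L)`; the flat ball
  -- must have radius `2R`.
  refine ⟨x₀, Real.exp (6 * L), 3 * L, L, Real.exp_pos _, hL, ?_, hball, sub_mem_direction hx₀,
    hLε, ?_, ?_⟩
  · rw [abs_of_pos (by linarith)]
    linarith
  · rintro t ⟨ht, ht'⟩
    have h1 : -t ≤ -L := by linarith
    constructor
    · have e : δ + (δ' - δ) * Real.exp t / (1 + Real.exp t) - δ' =
          -((δ' - δ) * Real.exp (-t) / (1 + Real.exp (-t))) := by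
        have := Real.exp_pos t
        rw [Real.exp_neg]
        field_simp
        ring
      rw [e, abs_neg]
      refine (abs_mul_div_one_add_exp_le _ (-t)).trans (le_trans ?_ hD)
      gcongr
    · calc Real.exp (2 * t) ≤ Real.exp (-2 * L) * Real.exp (6 * L) ^ 2 := by
            rw [← Real.exp_nat_mul, ← Real.exp_add]
            exact Real.exp_le_exp.2 (by push_cast; linarith)
        _ ≤ _ := by gcongr
  · rintro s ⟨hs, -⟩
    refine coeff_bounds_of_one_le δ δ' (le_trans ?_ hs)
    exact Real.one_le_exp (by linarith)

theorem exists_isTest_ne_zero (hk : 1 ≤ dim K) (hkd : dim K < d) :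
    ∃ φ, IsTest (domain K) φ ∧ φ ≠ 0 := by
  obtain ⟨x₀, hx₀⟩ := nonempty_of_one_le_dim hk
  obtain ⟨b, b₁, b₂, M, hb⟩ := exists_isCutoff
  have hV : 0 < Module.finrank ℝ (affineSpan ℝ K).directionᗮ := by
    have : (dim K : ℝ) < d := Nat.cast_lt.2 hkd
    rw [← Nat.cast_pos (α := ℝ), finrank_orthogonal_direction]
    linarith
  exact ⟨testFn (affineSpan ℝ K).direction x₀ b 0 1 2 1,
    isTest_testFn hb one_pos one_pos (by norm_num) (sub_mem_direction hx₀),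
    testFn_ne_zero hb one_pos one_pos hV⟩

theorem le_nu_self (hK : IsClosed K) (hc : Convex ℝ K) (hk : 1 ≤ dim K) (hkd : dim K < d)
    {p δ : ℝ} (hp : 1 < p) (hδ : δ ≤ 2) (hA : 0 ≤ (d : ℝ) - dim K + p * δ - 2 * p) :
    ((p - 1) * ((d : ℝ) - dim K) * ((d : ℝ) - dim K + p * δ - 2 * p) / p ^ 2) ^ p ≤
      nu p δ δ K := by
  obtain ⟨P, hP⟩ := exists_isNearestPointMap hK hc (nonempty_of_one_le_dim hk)
  obtain ⟨φ₀, hφ₀, hφ₀'⟩ := exists_isTest_ne_zero hk hkd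
  refine le_csInf ⟨_, φ₀, hφ₀, hφ₀', rfl⟩ ?_
  -- In the critical case the constant is `0` and nonnegativity of the quotients suffices; the Young
  -- argument needs a positive constant.
  rcases hA.eq_or_lt with hA | hA
  · rw [← hA, mul_zero, zero_div, Real.zero_rpow (by linarith)]
    exact bddBelow_quotients p δ δ K
  · rintro r ⟨φ, hφ, hne, rfl⟩
    rw [le_div_iff₀ (integral_weight_div_sq_mul_pos hP hK δ δ (by linarith) hφ hne)]
    have hd : (dim K : ℝ) < d := Nat.cast_lt.2 hkd
    exact rpow_mul_integral_le_integral_abs_H_rpow hP hK hp hδ hA (by linarith) hφ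

end Rellich

theorem theorem4p7 (d k : ℕ) (hk : 1 ≤ k) (hkd : k < d)
    (K : Set (Rellich.Space d)) (hK : IsClosed K) (hKconv : Convex ℝ K)
    (hdim : Rellich.dim K = k)
    (p δ δ' : ℝ) (hp : 1 < p) (hδ : 0 ≤ δ) (hδ' : 0 ≤ δ') :
    (0 ≤ (d : ℝ) - k + p * δ - 2 * p →
      Rellich.nu p δ δ' K ≤
        ((p - 1) * ((d : ℝ) - k) * ((d : ℝ) - k + p * δ - 2 * p) / p ^ 2) ^ p) ∧
    (Rellich.dimAtInfinity K = (k : EReal) →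
      0 ≤ (d : ℝ) - k + p * min δ δ' - 2 * p →
      Rellich.nu p δ δ' K ≤
        ((p - 1) * ((d : ℝ) - k) * ((d : ℝ) - k + p * min δ δ' - 2 * p) / p ^ 2) ^ p) ∧
    (δ = δ' → δ < 2 → 0 ≤ (d : ℝ) - k + p * δ - 2 * p →
      Rellich.nu p δ δ' K =
        ((p - 1) * ((d : ℝ) - k) * ((d : ℝ) - k + p * δ - 2 * p) / p ^ 2) ^ p) := by
  subst hdim
  have hloc := fun h => Rellich.nu_le_local (δ' := δ') hK hKconv hk hkd (δ := δ) hp h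
  refine ⟨hloc, fun hinf hA => ?_, ?_⟩
  -- If `δ ≤ δ'` the local bound already has the right exponent; flat balls at infinity matter only
  -- when `δ' ≤ δ`.
  · rcases le_total δ δ' with h | h
    · rw [min_eq_left h] at hA ⊢
      exact hloc hA
    · rw [min_eq_right h] at hA ⊢
      exact Rellich.nu_le_of_dimAtInfinity hK hKconv hk hkd hinf hp hA
  · rintro rfl h2 hA
    exact le_antisymm (hloc hA) (Rellich.le_nu_self hK hKconv hk hkd hp h2.le hA)
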